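/- Let $a\ge 0$, $b>0$, $c>0$, $d\ge 0$ satisfy $ac<b(c+d)$, and put $$m(ds,du)=a e^{-bs}\,ds\;c e^{-(c+d)u}\,du\quad\text{on }\mathbb R_+\times\mathbb R_+,\qquad \nu=\int m(ds,du)=\frac{ac}{b(c+d)}<1 .$$ Consider the branching process started at time $0$ from one individual in which every individual has, independently of all others, a Poisson random measure on $\mathbb R_+\times\mathbb R_+$ with intensity $m$, each point $(s,u)$ of which gives one child, born $s+u$ time units after its parent. For $t\ge 0$ let $Z_t$ be the total number of individuals born in $[0,t]$, including the ancestor (so $Z_0=1$ a.s.). Then, almost surely, $Z_t<\infty$ for all $t\ge0$, and $\mathbb E Z_t^2<\infty$ for all $t\ge 0$. Let $x_t=\mathbb E Z_t$, $y_t=\operatorname{Var} Z_t$ and $$w_r(t)=\mathbb E[(Z_{r+t}-Z_r)^2],\qquad r,t\ge 0 .$$ For every $t\ge 0$ the function $r\mapsto w_r(t)$ is integrable on $(0,\infty)$, and $$\int_0^\infty w_r(t)\,dr=\frac{1}{1-\nu}\int_0^\infty (x_{r+t}-x_r)^2\,dr+\frac{\nu}{1-\nu}\int_0^t \frac{(c+d)e^{-b(t-u)}-b\,e^{-(c+d)(t-u)}}{c+d-b}\,(x_u^2+y_u)\,du<\infty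 ,$$ where both integrals on the right converge and, in the case $b=c+d$, the fraction is read as its limit $(1+b(t-u))e^{-b(t-u)}$. Moreover, $\int_0^\infty w_r(t)\,dr$ is uniformly bounded in $t\ge 0$: there is a constant $C<\infty$ with $\int_0^\infty w_r(t)\,dr\le C$ for all $t\ge0$. -/

import Mathlib

open MeasureTheory ProbabilityTheory Set
open scoped ENNReal NNReal

noncomputable section

/-- `M` is a Poisson random measure on `E` with intensity measure `μ`, defined on the probability
space `(Ω, P)`: the numbers of points in measurable sets are random variables, Poisson distributed
with mean `μ B` (and a.s. infinite if `μ B = ∞`), and the numbers of points in finitely many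
pairwise disjoint measurable sets are independent. -/
structure IsPoissonRandomMeasure {Ω E : Type*} [MeasurableSpace Ω] [MeasurableSpace E]
    (M : Ω → Measure E) (μ : Measure E) (P : Measure Ω) : Prop where
  measurable : ∀ B : Set E, MeasurableSet B → Measurable (fun ω => M ω B)
  map_eq : ∀ B : Set E, MeasurableSet B → μ B ≠ ∞ →
    P.map (fun ω => M ω B) =
      (poissonMeasure (μ B).toNNReal).map (fun n : ℕ => (n : ℝ≥0∞))
  eq_top : ∀ B : Set E, MeasurableSet B → μ B = ∞ → ∀ᵐ ω ∂P, M ω B = ∞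
  indep : ∀ (n : ℕ) (B : Fin n → Set E), (∀ i, MeasurableSet (B i)) →
    Pairwise (fun i j => Disjoint (B i) (B j)) → iIndepFun (fun i ω => M ω (B i)) P

/-- The intensity measure `m(ds,du) = a e^{-bs} ds · c e^{-(c+d)u} du` on `ℝ₊ × ℝ₊`, regarded as a
measure on `ℝ × ℝ` that is carried by the closed first quadrant. -/
def offspringIntensity (a b c d : ℝ) : Measure (ℝ × ℝ) :=
  ((volume : Measure (ℝ × ℝ)).restrict (Ici 0 ×ˢ Ici 0)).withDensity
    (fun p => ENNReal.ofReal (a * Real.exp (-b * p.1) * (c * Real.exp (-(c + d) * p.2))))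

/-- The mean number of offspring `ν = ac / (b(c+d))`, the total mass of the intensity measure. -/
def meanOffspring (a b c d : ℝ) : ℝ := a * c / (b * (c + d))

/-- Random offspring data. Potential individuals are labelled by words over `ℕ`: the ancestor is
`[]` and the `k`-th child of `w` is `k :: w`. The individual `w` has `num w` children, and its
offspring point process consists of the points `(s,u) = pt w k`, `k < num w` (the values `pt w k`
with `num w ≤ k` play no role). -/
structure OffspringData (Ω : Type*) where
  num : List ℕ → Ω → ℕ
  pt : List ℕ → ℕ → Ω → ℝ × ℝ

namespace OffspringData

variable {Ω : Type*}

/-- The offspring point process of the individual `w`, as a random measure on `ℝ × ℝ`. -/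
def offspringMeasure (D : OffspringData Ω) (w : List ℕ) (ω : Ω) : Measure (ℝ × ℝ) :=
  ∑ k ∈ Finset.range (D.num w ω), Measure.dirac (D.pt w k ω)

/-- The offspring point processes of the different individuals are independent Poisson random
measures with intensity `m(ds,du) = a e^{-bs} ds · c e^{-(c+d)u} du`. -/
structure IsPoissonBranching [MeasurableSpace Ω] (D : OffspringData Ω) (a b c d : ℝ)
    (P : Measure Ω) : Prop where
  measurable_num : ∀ w, Measurable (D.num w)
  measurable_pt : ∀ w k, Measurable (D.pt w k)
  poisson : ∀ w, IsPoissonRandomMeasure (D.offspringMeasure w) (offspringIntensity a b c d) P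
  indep : iIndepFun
    (fun (w : List ℕ) (ω : Ω) => ((D.num w ω, fun k => D.pt w k ω) : ℕ × (ℕ → ℝ × ℝ))) P

/-- The individual with a given label is ever born: so is its parent `w`, and it is one of the
`num w` children of `w`. -/
def IsBorn (D : OffspringData Ω) (ω : Ω) : List ℕ → Prop
  | [] => True
  | k :: w => D.IsBorn ω w ∧ k < D.num w ω

/-- Birth times: the ancestor is born at time `0`, and a point `(s,u)` of the offspring process of
`w` is a child that is born `s + u` time units after `w`. -/
def birthTime (D : OffspringData Ω) (ω : Ω) : List ℕ → ℝ
  | [] => 0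
  | k :: w => D.birthTime ω w + ((D.pt w k ω).1 + (D.pt w k ω).2)

/-- The individuals that are born in the time interval `[0,t]`. -/
def bornBy (D : OffspringData Ω) (t : ℝ) (ω : Ω) : Set (List ℕ) :=
  {w | D.IsBorn ω w ∧ D.birthTime ω w ≤ t}

/-- The branching process `Z_t`: the number of individuals born up to time `t`, including the
ancestor. -/
def Z (D : OffspringData Ω) (t : ℝ) (ω : Ω) : ℝ := ((D.bornBy t ω).ncard : ℝ)

variable [MeasurableSpace Ω]

/-- The mean function `x_t = E Z_t`. -/
def x (D : OffspringData Ω) (P : Measure Ω) (t : ℝ) : ℝ := ∫ ω, D.Z t ω ∂P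

/-- The variance function `y_t = Var Z_t`. -/
def y (D : OffspringData Ω) (P : Measure Ω) (t : ℝ) : ℝ := variance (D.Z t) P

/-- The squared increment expectation `w_r(t) = E[(Z_{r+t} - Z_r)²]`. -/
def w (D : OffspringData Ω) (P : Measure Ω) (r t : ℝ) : ℝ :=
  ∫ ω, (D.Z (r + t) ω - D.Z r ω) ^ 2 ∂P

end OffspringData

/-- The function `v ↦ (q e^{-bv} - b e^{-qv}) / (q - b)`, with its limit `(1 + bv) e^{-bv}` as the
value in the case `q = b`. -/
def tailKernel (b q v : ℝ) : ℝ :=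
  if q = b then (1 + b * v) * Real.exp (-b * v)
  else (q * Real.exp (-b * v) - b * Real.exp (-q * v)) / (q - b)

end

/-! Let `ρ` be the law-intensity of the age at a birth, the image of `m` under `(s,u) ↦ s + u`, with
mass `ν < 1`. For `f ≥ 0` let `T(s)` be the sum of `f` over all birth times when the ancestor is
born at `s`. Splitting off the first generation, a Poisson process carrying independent copies of
the whole tree, gives for `μ(s) = E T(s)` and `q(s) = E T(s)²` the equations `μ(s) = f(s) + ∫ μ(s+v)
ρ(dv)` and `q(s) = μ(s)² + ∫ q(s+v) ρ(dv)`. The second holds because the variance of a marked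
Poisson sum is the integral of the second moment of the marks.

For `f = 1_{(0,t]}` and `s = -r` the sum `T(s)` is `Z_{r+t} - Z_r`, so the integral of `w_r(t)` over
`r` is that of `q` over `s < 0`. Since `v ≥ 0`, shifting by `v` adds the integral of `q` over
`(0,v)`; by Tonelli, `∫_{s<0} q = ∫_{s<0} μ² + ν ∫_{s<0} q + ∫_{s>0} q(s) ρ(s,∞) ds`
(`setLIntegral_iSup_renewalSq_eq`). For `0 < s ≤ t` one has `q(s) = E Z_{t-s}²`, for `s > t` it
vanishes, and `ρ(s,∞)` is `ν` times `tailKernel`. Solving for `∫_{s<0} q` gives the formula.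

Solving requires finiteness. It is proved for the first `n` generations, where each quantity obeys
`u_{n+1} ≤ K + ν u_n` with `u_0 = 0`, hence `u_n ≤ K/(1-ν)`. The constants depend only on `ν` and `∫
v ρ(dv)`, which also yields the bound uniform in `t`. -/

/-! ### Moments of the Poisson distribution. -/

/-- The Stein–Chen identity for the Poisson distribution. -/
theorem lintegral_natCast_mul_poissonMeasure (r : ℝ≥0) (g : ℕ → ℝ≥0∞) :
    ∫⁻ n : ℕ, (n : ℝ≥0∞) * g n ∂(poissonMeasure r) =
      r * ∫⁻ n : ℕ, g (n + 1) ∂(poissonMeasure r) := by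
  have key : ∀ n : ℕ, ((n + 1 : ℕ) : ℝ≥0∞) * poissonMeasure r {n + 1}
      = r * poissonMeasure r {n} := by
    intro n
    rw [poissonMeasure_singleton, poissonMeasure_singleton, ← ENNReal.ofReal_natCast,
      ← ENNReal.ofReal_coe_nnreal (p := r), ← ENNReal.ofReal_mul (by positivity),
      ← ENNReal.ofReal_mul (by positivity)]
    congr 1
    rw [Nat.factorial_succ]
    push_cast
    field_simp
    ring
  rw [lintegral_countable', lintegral_countable', tsum_eq_zero_add' ENNReal.summable,
    ← ENNReal.tsum_mul_left]
  simp only [Nat.cast_zero, zero_mul, zero_add]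
  refine tsum_congr fun n => ?_
  calc _ = (((n + 1 : ℕ) : ℝ≥0∞) * poissonMeasure r {n + 1}) * g (n + 1) := by ring
    _ = _ := by rw [key]; ring

theorem lintegral_natCast_poissonMeasure (r : ℝ≥0) :
    ∫⁻ n : ℕ, (n : ℝ≥0∞) ∂(poissonMeasure r) = r := by
  simpa using lintegral_natCast_mul_poissonMeasure r 1

theorem lintegral_natCast_sq_poissonMeasure (r : ℝ≥0) :
    ∫⁻ n : ℕ, (n : ℝ≥0∞) * n ∂(poissonMeasure r) = r * r + r := by
  rw [lintegral_natCast_mul_poissonMeasure r (fun n => n)]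
  simp only [Nat.cast_add, Nat.cast_one]
  rw [lintegral_add_right _ measurable_const, lintegral_natCast_poissonMeasure]
  simp [mul_add]

/-! ### First and second moments of Poisson integrals (Campbell's formulas). -/

namespace IsPoissonRandomMeasure

variable {Ω E : Type*} [MeasurableSpace Ω] [MeasurableSpace E] {M : Ω → Measure E}
  {μ : Measure E} {P : Measure Ω}

theorem measurable_measure (h : IsPoissonRandomMeasure M μ P) : Measurable M :=
  Measure.measurable_of_measurable_coe _ fun B hB => h.measurable B hB

variable [IsFiniteMeasure μ]

theorem lintegral_apply (h : IsPoissonRandomMeasure M μ P) {B : Set E} (hB : MeasurableSet B) :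
    ∫⁻ ω, M ω B ∂P = μ B := by
  have h1 := lintegral_map (μ := P) (f := fun x : ℝ≥0∞ => x) (by fun_prop) (h.measurable B hB)
  rw [← h1, h.map_eq B hB (measure_ne_top μ B), lintegral_map (by fun_prop) (by fun_prop),
    lintegral_natCast_poissonMeasure, ENNReal.coe_toNNReal (measure_ne_top μ B)]

theorem lintegral_apply_sq (h : IsPoissonRandomMeasure M μ P) {B : Set E}
    (hB : MeasurableSet B) : ∫⁻ ω, M ω B * M ω B ∂P = μ B * μ B + μ B := by
  have h1 := lintegral_map (μ := P) (f := fun x : ℝ≥0∞ => x * x) (by fun_prop) (h.measurable B hB)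
  rw [← h1, h.map_eq B hB (measure_ne_top μ B), lintegral_map (by fun_prop) (by fun_prop),
    lintegral_natCast_sq_poissonMeasure, ENNReal.coe_toNNReal (measure_ne_top μ B)]

theorem lintegral_apply_mul_of_disjoint (h : IsPoissonRandomMeasure M μ P) {A B : Set E}
    (hA : MeasurableSet A) (hB : MeasurableSet B) (hAB : Disjoint A B) :
    ∫⁻ ω, M ω A * M ω B ∂P = μ A * μ B := by
  have hi : IndepFun (fun ω => M ω A) (fun ω => M ω B) P := by
    have := (h.indep 2 ![A, B] (by intro i; fin_cases i <;> simpa)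
      (by
        intro i j hij
        fin_cases i <;> fin_cases j <;> simp_all [hAB.symm])).indepFun
        (show (0 : Fin 2) ≠ 1 by simp)
    simpa using this
  have := lintegral_mul_eq_lintegral_mul_lintegral_of_indepFun (h.measurable A hA)
    (h.measurable B hB) hi
  simp only [Pi.mul_apply] at this
  rw [this, h.lintegral_apply hA, h.lintegral_apply hB]

theorem lintegral_apply_mul (h : IsPoissonRandomMeasure M μ P) {A B : Set E}
    (hA : MeasurableSet A) (hB : MeasurableSet B) :
    ∫⁻ ω, M ω A * M ω B ∂P = μ A * μ B + μ (A ∩ B) := by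
  have hI := hA.inter hB
  have hAB := hA.diff hB
  have hBA := hB.diff hA
  have mI := h.measurable _ hI
  have mAB := h.measurable _ hAB
  have mBA := h.measurable _ hBA
  have d1 : Disjoint (A \ B) B := disjoint_sdiff_left
  have d2 : Disjoint (A ∩ B) (B \ A) := by
    rw [Set.disjoint_left]; rintro x ⟨hx, _⟩ ⟨_, hx'⟩; exact hx' hx
  have e1 : ∀ ν : Measure E, ν A = ν (A ∩ B) + ν (A \ B) :=
    fun ν => (measure_inter_add_sdiff A hB).symm
  have e2 : ∀ ν : Measure E, ν B = ν (A ∩ B) + ν (B \ A) := fun ν => by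
    rw [inter_comm]; exact (measure_inter_add_sdiff B hA).symm
  have : ∀ ω, M ω A * M ω B = M ω (A ∩ B) * M ω (A ∩ B) + M ω (A ∩ B) * M ω (B \ A)
      + M ω (A \ B) * M ω B := fun ω => by
    rw [e1 (M ω), add_mul, e2 (M ω), mul_add]
  simp_rw [this]
  rw [lintegral_add_left (by fun_prop), lintegral_add_left (by fun_prop), h.lintegral_apply_sq hI,
    h.lintegral_apply_mul_of_disjoint hI hBA d2, h.lintegral_apply_mul_of_disjoint hAB hB d1]
  rw [e1 μ, e2 μ]
  ring

theorem lintegral_lintegral (h : IsPoissonRandomMeasure M μ P) {φ : E → ℝ≥0∞}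
    (hφ : Measurable φ) : ∫⁻ ω, ∫⁻ p, φ p ∂(M ω) ∂P = ∫⁻ p, φ p ∂μ := by
  have hM := h.measurable_measure
  rw [← Measure.lintegral_bind hM.aemeasurable hφ.aemeasurable]
  congr 1
  ext B hB
  rw [Measure.bind_apply hB hM.aemeasurable, h.lintegral_apply hB]

/-- Under `P` weighted by `M B` the mean measure of `M` is `μ B • μ + μ.restrict B`. This equality
of measures need only be checked on sets, where it is `lintegral_apply_mul`, so no approximation of
`φ` is needed. -/
theorem lintegral_apply_mul_lintegral (h : IsPoissonRandomMeasure M μ P) {B : Set E}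
    (hB : MeasurableSet B) {φ : E → ℝ≥0∞} (hφ : Measurable φ) :
    ∫⁻ ω, M ω B * ∫⁻ p, φ p ∂(M ω) ∂P =
      μ B * (∫⁻ p, φ p ∂μ) + ∫⁻ p in B, φ p ∂μ := by
  have hM := h.measurable_measure
  have hMB := h.measurable B hB
  have hMφ : Measurable fun ω => ∫⁻ p, φ p ∂(M ω) := (Measure.measurable_lintegral hφ).comp hM
  have e := lintegral_withDensity_eq_lintegral_mul P hMB hMφ
  simp only [Pi.mul_apply] at e
  rw [← e, ← Measure.lintegral_bind hM.aemeasurable hφ.aemeasurable,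
    ← smul_eq_mul, ← lintegral_smul_measure, ← lintegral_add_measure]
  congr 1
  ext A hA
  have e' := lintegral_withDensity_eq_lintegral_mul P hMB (h.measurable A hA)
  simp only [Pi.mul_apply] at e'
  rw [Measure.bind_apply hA hM.aemeasurable, e', h.lintegral_apply_mul hB hA, Measure.add_apply,
    Measure.smul_apply, Measure.restrict_apply hA, smul_eq_mul, inter_comm]

/-- The same device once more, with `P` weighted by the integral of `φ` and the preceding lemma as
the check on sets. -/
theorem lintegral_lintegral_sq (h : IsPoissonRandomMeasure M μ P) {φ : E → ℝ≥0∞}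
    (hφ : Measurable φ) :
    ∫⁻ ω, (∫⁻ p, φ p ∂(M ω)) * (∫⁻ p, φ p ∂(M ω)) ∂P =
      (∫⁻ p, φ p ∂μ) * (∫⁻ p, φ p ∂μ) + ∫⁻ p, φ p * φ p ∂μ := by
  have hM := h.measurable_measure
  have hMφ : Measurable fun ω => ∫⁻ p, φ p ∂(M ω) := (Measure.measurable_lintegral hφ).comp hM
  have e := lintegral_withDensity_eq_lintegral_mul P hMφ hMφ
  simp only [Pi.mul_apply] at e
  have e2 := lintegral_withDensity_eq_lintegral_mul μ hφ hφ
  simp only [Pi.mul_apply] at e2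
  rw [← e, ← Measure.lintegral_bind hM.aemeasurable hφ.aemeasurable, ← e2,
    ← smul_eq_mul, ← lintegral_smul_measure, ← lintegral_add_measure]
  congr 1
  ext A hA
  have e' := lintegral_withDensity_eq_lintegral_mul P hMφ (h.measurable A hA)
  simp only [Pi.mul_apply] at e'
  rw [Measure.bind_apply hA hM.aemeasurable, e', Measure.add_apply,
    Measure.smul_apply, smul_eq_mul, withDensity_apply _ hA]
  simp_rw [mul_comm _ (M _ A)]
  rw [h.lintegral_apply_mul_lintegral hA hφ, mul_comm]

end IsPoissonRandomMeasure

/-! ### Independence and independently marked Poisson sums. -/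

theorem sum_range_eq_tsum_ite (n : ℕ) (g : ℕ → ℝ≥0∞) :
    ∑ k ∈ Finset.range n, g k = ∑' k, if k < n then g k else 0 := by
  rw [tsum_eq_sum (s := Finset.range n) (by intro k hk; simp_all)]
  exact Finset.sum_congr rfl fun k hk => by simp_all

namespace ProbabilityTheory

/-- Disjoint subfamilies of an independent family are independent. -/
theorem iIndepFun.indepFun_subfamilies {Ω ι β : Type*} {mΩ : MeasurableSpace Ω}
    [MeasurableSpace β] {P : Measure Ω} {f : ι → Ω → β} (hf : ∀ i, Measurable (f i))
    (h : iIndepFun f P) {S T : Set ι} (hST : Disjoint S T) :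
    IndepFun (fun ω (i : S) => f i ω) (fun ω (i : T) => f i ω) P := by
  have key : ∀ U : Set ι, MeasurableSpace.comap (fun ω (i : U) => f i ω) MeasurableSpace.pi
      ≤ ⨆ i ∈ U, MeasurableSpace.comap (f i) inferInstance := by
    intro U
    rw [← measurable_iff_comap_le]
    refine @measurable_pi_lambda _ _ _ (_) _ _ fun i => ?_
    rw [measurable_iff_comap_le]
    exact le_iSup₂_of_le (i : ι) i.2 le_rfl
  rw [IndepFun_iff_Indep]
  exact indep_of_indep_of_le_left (indep_of_indep_of_le_right
    (indep_iSup_of_disjoint (fun i => (hf i).comap_le) h hST) (key T)) (key S)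

/-- Integration of a function of two independent random variables. -/
theorem IndepFun.lintegral_comp {Ω α β : Type*} {mΩ : MeasurableSpace Ω} [MeasurableSpace α]
    [MeasurableSpace β] {P : Measure Ω} [IsFiniteMeasure P] {X : Ω → α} {Y : Ω → β}
    (h : IndepFun X Y P) (hX : Measurable X) (hY : Measurable Y) {F : α → β → ℝ≥0∞}
    (hF : Measurable fun p : α × β => F p.1 p.2) :
    ∫⁻ ω, F (X ω) (Y ω) ∂P = ∫⁻ ω, ∫⁻ ω', F (X ω) (Y ω') ∂P ∂P := by
  have e := (indepFun_iff_map_prod_eq_prod_map_map hX.aemeasurable hY.aemeasurable).1 h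
  rw [← lintegral_map (μ := P) (g := fun ω => (X ω, Y ω)) hF (hX.prodMk hY), e,
    lintegral_prod _ hF.aemeasurable, lintegral_map hF.lintegral_prod_right' hX]
  refine lintegral_congr fun ω => ?_
  exact lintegral_map (by fun_prop) hY

end ProbabilityTheory

section MarkedSum

variable {Ω E B : Type*} [MeasurableSpace Ω] [MeasurableSpace E] [MeasurableSpace B]
  {P : Measure Ω} [IsProbabilityMeasure P] {X : Ω → ℕ × (ℕ → E)} {Y : ℕ → Ω → B}
  {μ : Measure E} [IsFiniteMeasure μ] {G : E → B → ℝ≥0∞} {φ ψ : E → ℝ≥0∞}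

theorem lintegral_sum_dirac (x : ℕ × (ℕ → E)) {φ : E → ℝ≥0∞} (hφ : Measurable φ) :
    ∫⁻ p, φ p ∂(∑ k ∈ Finset.range x.1, Measure.dirac (x.2 k)) =
      ∑' k, if k < x.1 then φ (x.2 k) else 0 := by
  rw [lintegral_finsetSum_measure, ← sum_range_eq_tsum_ite]
  exact Finset.sum_congr rfl fun k _ => lintegral_dirac' _ hφ

theorem measurable_ite_lt {C : Type*} [MeasurableSpace C] {g : E → C → ℝ≥0∞}
    (hg : Measurable fun p : E × C => g p.1 p.2) (k : ℕ) :
    Measurable fun p : (ℕ × (ℕ → E)) × C => if k < p.1.1 then g (p.1.2 k) p.2 else 0 := by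
  refine Measurable.ite ?_ ?_ measurable_const
  · exact (measurable_fst.comp measurable_fst) (measurableSet_Ioi (a := k))
  · exact hg.comp (f := fun p : (ℕ × (ℕ → E)) × C => (p.1.2 k, p.2)) (by fun_prop)

theorem measurable_ite_lt' {g : E → ℝ≥0∞} (hg : Measurable g) (k : ℕ) :
    Measurable fun p : ℕ × (ℕ → E) => if k < p.1 then g (p.2 k) else 0 :=
  (measurable_ite_lt (C := Unit) (g := fun e _ => g e) (by fun_prop) k).comp
    (f := fun x => (x, ())) (by fun_prop)

/-- First moment of a sum of independent marks over the points of a Poisson process. -/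
theorem lintegral_marked_sum (hX : Measurable X) (hY : ∀ k, Measurable (Y k))
    (hM : IsPoissonRandomMeasure
      (fun ω => ∑ k ∈ Finset.range (X ω).1, Measure.dirac ((X ω).2 k)) μ P)
    (hXY : ∀ k, IndepFun X (Y k) P) (hG : Measurable fun p : E × B => G p.1 p.2)
    (hφ : Measurable φ) (hGφ : ∀ k p, ∫⁻ ω, G p (Y k ω) ∂P = φ p) :
    ∫⁻ ω, ∑' k, (if k < (X ω).1 then G ((X ω).2 k) (Y k ω) else 0) ∂P = ∫⁻ p, φ p ∂μ := by
  rw [← hM.lintegral_lintegral hφ]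
  simp_rw [lintegral_sum_dirac _ hφ]
  rw [lintegral_tsum, lintegral_tsum]
  · refine tsum_congr fun k => ?_
    rw [(hXY k).lintegral_comp hX (hY k) (F := fun x y => if k < x.1 then G (x.2 k) y else 0)
      (measurable_ite_lt hG k)]
    refine lintegral_congr fun ω => ?_
    split_ifs
    · exact hGφ k _
    · simp
  · exact fun k => ((measurable_ite_lt' hφ k).comp hX).aemeasurable
  · exact fun k => ((measurable_ite_lt hG k).comp (hX.prodMk (hY k))).aemeasurable

/-- Second moment of a sum of independent marks over the points of a Poisson process. -/
theorem lintegral_marked_sum_sq (hX : Measurable X) (hY : ∀ k, Measurable (Y k))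
    (hM : IsPoissonRandomMeasure
      (fun ω => ∑ k ∈ Finset.range (X ω).1, Measure.dirac ((X ω).2 k)) μ P)
    (hXY : ∀ k, IndepFun X (Y k) P)
    (hYY : ∀ k j, k ≠ j → IndepFun (Y k) (Y j) P)
    (hXYY : ∀ k j, k ≠ j → IndepFun X (fun ω => (Y k ω, Y j ω)) P)
    (hG : Measurable fun p : E × B => G p.1 p.2)
    (hφ : Measurable φ) (hGφ : ∀ k p, ∫⁻ ω, G p (Y k ω) ∂P = φ p)
    (hψ : Measurable ψ) (hGψ : ∀ k p, ∫⁻ ω, G p (Y k ω) * G p (Y k ω) ∂P = ψ p)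
    (hfin : ∫⁻ p, φ p * φ p ∂μ ≠ ∞) :
    ∫⁻ ω, (∑' k, if k < (X ω).1 then G ((X ω).2 k) (Y k ω) else 0) *
        (∑' k, if k < (X ω).1 then G ((X ω).2 k) (Y k ω) else 0) ∂P =
      (∫⁻ p, φ p ∂μ) * (∫⁻ p, φ p ∂μ) + ∫⁻ p, ψ p ∂μ := by
  have mA : ∀ k, Measurable fun ω => if k < (X ω).1 then G ((X ω).2 k) (Y k ω) else 0 :=
    fun k => (measurable_ite_lt hG k).comp (hX.prodMk (hY k))
  have mφ : ∀ k, Measurable fun ω => if k < (X ω).1 then φ ((X ω).2 k) else 0 :=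
    fun k => (measurable_ite_lt' hφ k).comp hX
  have mφφ : ∀ k, Measurable fun ω =>
      if k < (X ω).1 then φ ((X ω).2 k) * φ ((X ω).2 k) else 0 :=
    fun k => (measurable_ite_lt' (hφ.mul hφ) k).comp hX
  have mψ : ∀ k, Measurable fun ω => if k < (X ω).1 then ψ ((X ω).2 k) else 0 :=
    fun k => (measurable_ite_lt' hψ k).comp hX
  have hsq := hM.lintegral_lintegral_sq hφ
  have hφφ := hM.lintegral_lintegral (hφ.mul hφ)
  have hψM := hM.lintegral_lintegral hψ
  simp only [Pi.mul_apply] at hφφ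
  simp_rw [lintegral_sum_dirac _ hφ] at hsq
  simp_rw [lintegral_sum_dirac _ hψ] at hψM
  simp_rw [lintegral_sum_dirac (φ := fun p => φ p * φ p) _ (hφ.mul hφ)] at hφφ
  have expand : ∀ A : ℕ → Ω → ℝ≥0∞, (∀ k, Measurable (A k)) →
      ∫⁻ ω, (∑' k, A k ω) * (∑' k, A k ω) ∂P = ∑' k, ∑' j, ∫⁻ ω, A k ω * A j ω ∂P := by
    intro A hA
    simp_rw [← ENNReal.tsum_mul_right, ← ENNReal.tsum_mul_left]
    have m : ∀ k j, Measurable fun ω => A k ω * A j ω := fun k j => (hA k).mul (hA j)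
    rw [lintegral_tsum fun k => (Measurable.tsum (m k)).aemeasurable]
    exact tsum_congr fun k => lintegral_tsum fun j => (m k j).aemeasurable
  have diag : ∀ A : ℕ → Ω → ℝ≥0∞, (∀ k, Measurable (A k)) →
      ∫⁻ ω, (∑' k, A k ω) ∂P = ∑' k, ∑' j, if k = j then ∫⁻ ω, A k ω ∂P else 0 := by
    intro A hA
    rw [lintegral_tsum fun k => (hA k).aemeasurable]
    exact tsum_congr fun k => by simp
  rw [expand _ mφ] at hsq
  rw [diag _ mφφ] at hφφ
  rw [diag _ mψ] at hψM
  rw [expand _ mA]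
  -- The joint law of the labelled points is unknown; only their unordered sum is Poisson. So the
  -- double sum is compared with that of the unmarked sum of `φ`, whose second moment is known: off
  -- the diagonal the two agree, on it `ψ` replaces `φ * φ`. Adding `∫ φ * φ` to both sides avoids a
  -- subtraction.
  refine (ENNReal.add_left_inj hfin).1 ?_
  rw [add_right_comm, ← hsq, ← hφφ, ← hψM]
  simp_rw [← ENNReal.tsum_add]
  refine tsum_congr fun k => tsum_congr fun j => ?_
  by_cases hkj : k = j
  · subst hkj
    simp only [if_true]
    rw [add_comm]
    congr 1
    · refine lintegral_congr fun ω => ?_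
      split_ifs <;> simp
    · have := (hXY k).lintegral_comp hX (hY k)
        (F := fun x y => if k < x.1 then G (x.2 k) y * G (x.2 k) y else 0)
        (measurable_ite_lt (g := fun e y => G e y * G e y) (hG.mul hG) k)
      calc _ = ∫⁻ ω, (if k < (X ω).1 then
              G ((X ω).2 k) (Y k ω) * G ((X ω).2 k) (Y k ω) else 0) ∂P :=
            lintegral_congr fun ω => by split_ifs <;> simp
        _ = _ := by
            rw [this]
            refine lintegral_congr fun ω => ?_
            split_ifs
            · exact hGψ k _
            · simp
  · simp only [if_neg hkj, add_zero]
    have m1 := measurable_ite_lt hG k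
    have m2 := measurable_ite_lt hG j
    have := (hXYY k j hkj).lintegral_comp hX ((hY k).prodMk (hY j))
      (F := fun x y => (if k < x.1 then G (x.2 k) y.1 else 0) *
        (if j < x.1 then G (x.2 j) y.2 else 0))
      ((m1.comp (f := fun p : (ℕ × (ℕ → E)) × (B × B) => (p.1, p.2.1)) (by fun_prop)).mul
        (m2.comp (f := fun p : (ℕ × (ℕ → E)) × (B × B) => (p.1, p.2.2)) (by fun_prop)))
    simp only at this
    rw [this]
    refine lintegral_congr fun ω => ?_
    have mG : ∀ e, Measurable (G e) := fun e => hG.comp (measurable_const.prodMk measurable_id)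
    split_ifs
    · rw [← hGφ k, ← hGφ j]
      exact lintegral_mul_eq_lintegral_mul_lintegral_of_indepFun ((mG _).comp (hY k))
        ((mG _).comp (hY j)) ((hYY k j hkj).comp (mG _) (mG _))
    all_goals simp

end MarkedSum

/-! ### Moments of the first `n` generations: the renewal recursions. -/

/-- The offspring points of all potential individuals of a branching process. -/
abbrev OffspringTree := List ℕ → ℕ × (ℕ → ℝ × ℝ)

namespace OffspringTree

/-- The tree of the descendants of the `k`-th child of the ancestor. -/
def subtree (τ : OffspringTree) (k : ℕ) : OffspringTree := fun w => τ (w ++ [k])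

theorem measurable_subtree (k : ℕ) : Measurable fun τ : OffspringTree => τ.subtree k :=
  measurable_pi_lambda _ fun _ => measurable_pi_apply _

/-- The sum of the values of `f` at the birth times of all individuals of the first `n`
generations, if the ancestor is born at time `s`. -/
noncomputable def progeny (f : ℝ → ℝ≥0∞) : ℕ → ℝ → OffspringTree → ℝ≥0∞
  | 0, _, _ => 0
  | n + 1, s, τ => f s + ∑' k, if k < (τ []).1 then
      progeny f n (s + (((τ []).2 k).1 + ((τ []).2 k).2)) (τ.subtree k) else 0

theorem measurable_progeny {f : ℝ → ℝ≥0∞} (hf : Measurable f) (n : ℕ) :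
    Measurable fun p : ℝ × OffspringTree => progeny f n p.1 p.2 := by
  induction n with
  | zero => exact measurable_const
  | succ n ih =>
    simp only [progeny]
    refine (hf.comp measurable_fst).add (Measurable.tsum fun k => ?_)
    have h0 : Measurable fun p : ℝ × OffspringTree => p.2 [] :=
      (measurable_pi_apply []).comp measurable_snd
    refine Measurable.ite ?_ ?_ measurable_const
    · exact (measurable_fst.comp h0) (measurableSet_Ioi (a := k))
    · have h1 : Measurable fun p : ℝ × OffspringTree => (p.2 []).2 k :=
        (measurable_pi_apply k).comp (measurable_snd.comp h0)
      exact ih.comp ((measurable_fst.add (h1.fst.add h1.snd)).prodMk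
        ((measurable_subtree k).comp measurable_snd))

end OffspringTree

/-- The mean of `OffspringTree.progeny`, for displacements with intensity `ρ`. -/
noncomputable def renewalMean (ρ : Measure ℝ) (f : ℝ → ℝ≥0∞) : ℕ → ℝ → ℝ≥0∞
  | 0, _ => 0
  | n + 1, s => f s + ∫⁻ v, renewalMean ρ f n (s + v) ∂ρ

/-- The second moment of `OffspringTree.progeny`, for displacements with intensity `ρ`. -/
noncomputable def renewalSq (ρ : Measure ℝ) (f : ℝ → ℝ≥0∞) : ℕ → ℝ → ℝ≥0∞
  | 0, _ => 0
  | n + 1, s => renewalMean ρ f (n + 1) s * renewalMean ρ f (n + 1) s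
      + ∫⁻ v, renewalSq ρ f n (s + v) ∂ρ

section Renewal

variable {ρ : Measure ℝ} [IsFiniteMeasure ρ] {f : ℝ → ℝ≥0∞}

theorem measurable_renewalMean (hf : Measurable f) (n : ℕ) :
    Measurable (renewalMean ρ f n) := by
  induction n with
  | zero => exact measurable_const
  | succ n ih =>
    refine hf.add ?_
    exact (ih.comp (measurable_fst.add measurable_snd)).lintegral_prod_right'
      (f := fun p : ℝ × ℝ => renewalMean ρ f n (p.1 + p.2))

theorem measurable_renewalSq (hf : Measurable f) (n : ℕ) :
    Measurable (renewalSq ρ f n) := by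
  induction n with
  | zero => exact measurable_const
  | succ n ih =>
    refine ((measurable_renewalMean hf _).mul (measurable_renewalMean hf _)).add ?_
    exact (ih.comp (measurable_fst.add measurable_snd)).lintegral_prod_right'
      (f := fun p : ℝ × ℝ => renewalSq ρ f n (p.1 + p.2))

/-- The bound may depend on `n`: it only supplies the finiteness needed in
`lintegral_marked_sum_sq`, without subcriticality. -/
theorem exists_renewalMean_le {C : ℝ≥0} (hf : ∀ s, f s ≤ C) (n : ℕ) :
    ∃ K : ℝ≥0, ∀ s, renewalMean ρ f n s ≤ K := by
  induction n with
  | zero => exact ⟨0, fun s => by simp [renewalMean]⟩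
  | succ n ih =>
    obtain ⟨K, hK⟩ := ih
    refine ⟨C + K * (ρ univ).toNNReal, fun s => ?_⟩
    push_cast
    rw [ENNReal.coe_toNNReal (measure_ne_top ρ univ), ← lintegral_const]
    exact add_le_add (hf s) (lintegral_mono fun v => hK _)

end Renewal

/-- The intensity of the ages at which an individual has children. -/
noncomputable def displacementIntensity (a b c d : ℝ) : Measure ℝ :=
  (offspringIntensity a b c d).map fun p => p.1 + p.2

namespace OffspringData

variable {Ω : Type*}

/-- The offspring points of all individuals, as a function on the probability space. -/
def tree (D : OffspringData Ω) (ω : Ω) : OffspringTree :=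
  fun w => (D.num w ω, fun k => D.pt w k ω)

/-- The offspring data of the descendants of the `k`-th child of the ancestor. -/
def descendants (D : OffspringData Ω) (k : ℕ) : OffspringData Ω where
  num w := D.num (w ++ [k])
  pt w := D.pt (w ++ [k])

variable [MeasurableSpace Ω] {D : OffspringData Ω} {a b c d : ℝ} {P : Measure Ω}

theorem IsPoissonBranching.measurable_tree_apply (hD : D.IsPoissonBranching a b c d P)
    (w : List ℕ) : Measurable fun ω => D.tree ω w :=
  (hD.measurable_num w).prodMk (measurable_pi_lambda _ fun k => hD.measurable_pt w k)

theorem IsPoissonBranching.measurable_tree (hD : D.IsPoissonBranching a b c d P) :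
    Measurable D.tree :=
  measurable_pi_lambda _ hD.measurable_tree_apply

theorem IsPoissonBranching.descendants (hD : D.IsPoissonBranching a b c d P) (k : ℕ) :
    (D.descendants k).IsPoissonBranching a b c d P where
  measurable_num _ := hD.measurable_num _
  measurable_pt _ := hD.measurable_pt _
  poisson _ := hD.poisson _
  indep := hD.indep.precomp (g := fun w => w ++ [k]) fun _ _ h => List.append_cancel_right h

/-- A child is labelled by prepending a letter, so the last letter of a label names the ancestor's
child it descends from; the root's data and the subtrees thus use disjoint sets of labels. -/
theorem IsPoissonBranching.indepFun_root_descendants (hD : D.IsPoissonBranching a b c d P) :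
    IndepFun (fun ω => D.tree ω []) (fun ω k => (D.descendants k).tree ω) P := by
  have h := iIndepFun.indepFun_subfamilies hD.measurable_tree_apply hD.indep
    (S := {[]}) (T := {w | ∃ (v : List ℕ) (k : ℕ), w = v ++ [k]}) (by
      rw [Set.disjoint_singleton_left]
      rintro ⟨v, k, h⟩
      simp at h)
  exact h.comp (φ := fun g : (({[]} : Set (List ℕ)) → ℕ × (ℕ → ℝ × ℝ)) => g ⟨[], rfl⟩)
     (ψ := fun g (k : ℕ) v => g ⟨v ++ [k], v, k, rfl⟩)
    (measurable_pi_apply (X := fun _ : ({[]} : Set (List ℕ)) => ℕ × (ℕ → ℝ × ℝ)) ⟨[], rfl⟩)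
    (by fun_prop)

theorem IsPoissonBranching.indepFun_root_descendant (hD : D.IsPoissonBranching a b c d P)
    (k : ℕ) : IndepFun (fun ω => D.tree ω []) (D.descendants k).tree P :=
  hD.indepFun_root_descendants.comp (φ := id) (ψ := fun g : ℕ → OffspringTree => g k)
    measurable_id (by fun_prop)

theorem IsPoissonBranching.indepFun_root_descendant_pair (hD : D.IsPoissonBranching a b c d P)
    (k j : ℕ) : IndepFun (fun ω => D.tree ω [])
      (fun ω => ((D.descendants k).tree ω, (D.descendants j).tree ω)) P :=
  hD.indepFun_root_descendants.comp (φ := id) (ψ := fun g : ℕ → OffspringTree => (g k, g j))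
    measurable_id (by fun_prop)

theorem IsPoissonBranching.indepFun_descendants (hD : D.IsPoissonBranching a b c d P)
    {k j : ℕ} (hkj : k ≠ j) :
    IndepFun (D.descendants k).tree (D.descendants j).tree P := by
  have h := iIndepFun.indepFun_subfamilies hD.measurable_tree_apply hD.indep
    (S := {w | ∃ v, w = v ++ [k]}) (T := {w | ∃ v, w = v ++ [j]}) (by
      rw [Set.disjoint_left]
      rintro _ ⟨v, rfl⟩ ⟨v', h⟩
      have := congrArg List.getLast? h
      simp at this
      exact hkj this)
  exact h.comp (φ := fun g v => g ⟨v ++ [k], v, rfl⟩) (ψ := fun g v => g ⟨v ++ [j], v, rfl⟩)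
    (measurable_pi_lambda _ fun v => measurable_pi_apply _)
    (measurable_pi_lambda _ fun v => measurable_pi_apply _)

variable {f : ℝ → ℝ≥0∞}

theorem measurable_add_displacement (s : ℝ) :
    Measurable fun p : ℝ × ℝ => s + (p.1 + p.2) := by fun_prop

theorem lintegral_displacement {g : ℝ → ℝ≥0∞} (hg : Measurable g) (s : ℝ) :
    ∫⁻ p, g (s + (p.1 + p.2)) ∂(offspringIntensity a b c d)
      = ∫⁻ v, g (s + v) ∂(displacementIntensity a b c d) := by
  rw [displacementIntensity, lintegral_map (by fun_prop) (by fun_prop)]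

theorem measurable_progeny_tree (hD : D.IsPoissonBranching a b c d P) (hf : Measurable f)
    (n : ℕ) (s : ℝ) : Measurable fun ω => OffspringTree.progeny f n s (D.tree ω) :=
  (OffspringTree.measurable_progeny hf n).comp (measurable_const.prodMk hD.measurable_tree)

theorem measurable_progeny_displacement (hf : Measurable f) (n : ℕ) (s : ℝ) :
    Measurable fun p : (ℝ × ℝ) × OffspringTree =>
      OffspringTree.progeny f n (s + (p.1.1 + p.1.2)) p.2 :=
  (OffspringTree.measurable_progeny hf n).comp
    (f := fun p : (ℝ × ℝ) × OffspringTree => (s + (p.1.1 + p.1.2), p.2))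
    (((measurable_add_displacement s).comp measurable_fst).prodMk measurable_snd)

variable [IsProbabilityMeasure P] [IsFiniteMeasure (offspringIntensity a b c d)]

instance : IsFiniteMeasure (displacementIntensity a b c d) := by
  unfold displacementIntensity; infer_instance

theorem IsPoissonBranching.lintegral_progeny (hD : D.IsPoissonBranching a b c d P)
    (hf : Measurable f) (n : ℕ) (s : ℝ) :
    ∫⁻ ω, OffspringTree.progeny f n s (D.tree ω) ∂P =
      renewalMean (displacementIntensity a b c d) f n s := by
  induction n generalizing D s with
  | zero => simp [OffspringTree.progeny, renewalMean]
  | succ n ih =>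
    simp only [OffspringTree.progeny, renewalMean]
    rw [lintegral_add_left measurable_const, lintegral_const, measure_univ, mul_one]
    congr 1
    rw [← lintegral_displacement (measurable_renewalMean hf n)]
    exact lintegral_marked_sum (X := fun ω => D.tree ω []) (Y := fun k => (D.descendants k).tree)
      (G := fun p τ => OffspringTree.progeny f n (s + (p.1 + p.2)) τ)
      (hD.measurable_tree_apply _) (fun k => (hD.descendants k).measurable_tree) (hD.poisson [])
      hD.indepFun_root_descendant (measurable_progeny_displacement hf n s)
      ((measurable_renewalMean hf n).comp (measurable_add_displacement s))
      (fun k p => ih (hD.descendants k) _)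

theorem IsPoissonBranching.lintegral_progeny_sq (hD : D.IsPoissonBranching a b c d P)
    (hf : Measurable f) {C : ℝ≥0} (hC : ∀ s, f s ≤ C) (n : ℕ) (s : ℝ) :
    ∫⁻ ω, OffspringTree.progeny f n s (D.tree ω) * OffspringTree.progeny f n s (D.tree ω) ∂P =
      renewalSq (displacementIntensity a b c d) f n s := by
  induction n generalizing D s with
  | zero => simp [OffspringTree.progeny, renewalSq]
  | succ n ih =>
    set ρ := displacementIntensity a b c d with hρ
    have h1 := lintegral_marked_sum (X := fun ω => D.tree ω [])
      (Y := fun k => (D.descendants k).tree)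
      (G := fun p τ => OffspringTree.progeny f n (s + (p.1 + p.2)) τ)
      (hD.measurable_tree_apply _) (fun k => (hD.descendants k).measurable_tree) (hD.poisson [])
      hD.indepFun_root_descendant (measurable_progeny_displacement hf n s)
      ((measurable_renewalMean hf n).comp (measurable_add_displacement s))
      (fun k p => (hD.descendants k).lintegral_progeny hf n _)
    have h2 := lintegral_marked_sum_sq (X := fun ω => D.tree ω [])
      (Y := fun k => (D.descendants k).tree)
      (G := fun p τ => OffspringTree.progeny f n (s + (p.1 + p.2)) τ)
      (hD.measurable_tree_apply _) (fun k => (hD.descendants k).measurable_tree) (hD.poisson [])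
      hD.indepFun_root_descendant (fun _ _ => hD.indepFun_descendants)
      (fun k j _ => hD.indepFun_root_descendant_pair k j)
      (measurable_progeny_displacement hf n s)
      ((measurable_renewalMean hf n).comp (measurable_add_displacement s))
      (fun k p => (hD.descendants k).lintegral_progeny hf n _)
      ((measurable_renewalSq hf n).comp (measurable_add_displacement s))
      (fun k p => ih (hD.descendants k) _)
      (by
        obtain ⟨K, hK⟩ := exists_renewalMean_le (ρ := ρ) hC n
        refine ne_of_lt (lt_of_le_of_lt
          (lintegral_mono (g := fun _ => (K : ℝ≥0∞) * K) fun p => mul_le_mul' (hK _) (hK _)) ?_)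
        rw [lintegral_const]
        exact ENNReal.mul_lt_top (ENNReal.mul_lt_top (by simp) (by simp)) (measure_lt_top _ _))
    simp only [Function.comp_def] at h1 h2
    rw [lintegral_displacement (measurable_renewalMean hf n)] at h1 h2
    rw [lintegral_displacement (measurable_renewalSq hf n)] at h2
    have mS : Measurable fun ω => ∑' k, if k < (D.tree ω []).1 then
        OffspringTree.progeny f n (s + (((D.tree ω []).2 k).1 + ((D.tree ω []).2 k).2))
          ((D.descendants k).tree ω) else 0 :=
      Measurable.tsum fun k => (measurable_ite_lt
        (g := fun (p : ℝ × ℝ) τ => OffspringTree.progeny f n (s + (p.1 + p.2)) τ)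
        (measurable_progeny_displacement hf n s) k).comp
        ((hD.measurable_tree_apply []).prodMk (hD.descendants k).measurable_tree)
    have hprog : ∀ ω, OffspringTree.progeny f (n + 1) s (D.tree ω) = f s + ∑' k,
        if k < (D.tree ω []).1 then
        OffspringTree.progeny f n (s + (((D.tree ω []).2 k).1 + ((D.tree ω []).2 k).2))
          ((D.descendants k).tree ω) else 0 := fun ω => rfl
    obtain ⟨S, hS⟩ : ∃ S : Ω → ℝ≥0∞, ∀ ω, S ω = ∑' k, if k < (D.tree ω []).1 then
        OffspringTree.progeny f n (s + (((D.tree ω []).2 k).1 + ((D.tree ω []).2 k).2))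
          ((D.descendants k).tree ω) else 0 := ⟨_, fun _ => rfl⟩
    simp only [← hS] at h1 h2 mS hprog
    simp_rw [hprog]
    -- After taking expectations, `f² + 2 f E S` and the part `(E S)²` of `E S²` recombine to the
    -- square of the mean; the rest of `E S²` is the integral of `renewalSq`.
    have e : ∀ x : ℝ≥0∞, (f s + x) * (f s + x) = f s * f s + (2 * f s) * x + x * x :=
      fun x => by ring
    simp only [renewalSq, renewalMean]
    simp_rw [e]
    rw [lintegral_add_right _ (by fun_prop : Measurable fun ω => S ω * S ω),
      lintegral_add_right _ (mS.const_mul _),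
      lintegral_const_mul _ mS, lintegral_const, measure_univ, mul_one, h1, h2]
    ring

end OffspringData

/-! ### Passage to all generations. -/

theorem ENNReal.tsum_list_concat {α : Type*} (g : List α → ℝ≥0∞) :
    ∑' w, g w = g [] + ∑' k, ∑' v, g (v ++ [k]) := by
  have hb : Function.Bijective
      (Sum.elim (fun _ : Unit => ([] : List α)) (fun p : α × List α => p.2 ++ [p.1])) := by
    refine ⟨?_, fun w => ?_⟩
    · rintro (_ | ⟨k, v⟩) (_ | ⟨k', v'⟩) h
      · rfl
      · simp at h
      · simp at h
      · have h' : v = v' ∧ k = k' := by simpa using h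
        rw [h'.1, h'.2]
    · rcases List.eq_nil_or_concat w with rfl | ⟨v, k, rfl⟩
      · exact ⟨Sum.inl (), rfl⟩
      · exact ⟨Sum.inr (k, v), by simp⟩
  rw [← (Equiv.ofBijective _ hb).tsum_eq g, ENNReal.summable.tsum_sum ENNReal.summable,
    ← ENNReal.tsum_prod]
  simp

namespace OffspringData

variable {Ω : Type*}

theorem isBorn_append (D : OffspringData Ω) (ω : Ω) (v : List ℕ) (k : ℕ) :
    D.IsBorn ω (v ++ [k]) ↔ k < D.num [] ω ∧ (D.descendants k).IsBorn ω v := by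
  induction v with
  | nil => simp [IsBorn]
  | cons j v ih =>
    change D.IsBorn ω (v ++ [k]) ∧ j < D.num (v ++ [k]) ω ↔ _
    rw [ih, and_assoc]
    rfl

theorem birthTime_append (D : OffspringData Ω) (ω : Ω) (v : List ℕ) (k : ℕ) :
    D.birthTime ω (v ++ [k]) =
      ((D.pt [] k ω).1 + (D.pt [] k ω).2) + (D.descendants k).birthTime ω v := by
  induction v with
  | nil => simp [birthTime]
  | cons j v ih =>
    change D.birthTime ω (v ++ [k]) + _ = _
    rw [ih, add_assoc]
    rfl

open Classical in
/-- The sum of the values of `f` at the birth times of all individuals, if the ancestor is born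
at time `s`. -/
noncomputable def total (D : OffspringData Ω) (f : ℝ → ℝ≥0∞) (s : ℝ) (ω : Ω) : ℝ≥0∞ :=
  ∑' w, if D.IsBorn ω w then f (s + D.birthTime ω w) else 0

open Classical in
-- The recursion peels off the ancestor, whereas `IsBorn` and `birthTime` recurse at the youngest
-- end of a label. Splitting words at their last letter reconciles the two; word length is the
-- generation.
theorem progeny_eq_tsum (D : OffspringData Ω) (f : ℝ → ℝ≥0∞) (n : ℕ) (s : ℝ) (ω : Ω) :
    OffspringTree.progeny f n s (D.tree ω) =
      ∑' w, if w.length < n ∧ D.IsBorn ω w then f (s + D.birthTime ω w) else 0 := by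
  induction n generalizing D s with
  | zero => simp [OffspringTree.progeny]
  | succ n ih =>
    rw [ENNReal.tsum_list_concat]
    have h : OffspringTree.progeny f (n + 1) s (D.tree ω) = f s + ∑' k,
        if k < D.num [] ω then OffspringTree.progeny f n
          (s + ((D.pt [] k ω).1 + (D.pt [] k ω).2)) ((D.descendants k).tree ω) else 0 := rfl
    rw [h]
    congr 1
    · simp [IsBorn, birthTime]
    · refine tsum_congr fun k => ?_
      rw [ih]
      simp only [isBorn_append, birthTime_append, add_assoc, List.length_append,
        List.length_singleton, Nat.add_lt_add_iff_right]
      by_cases hk : k < D.num [] ω <;> simp [hk]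

theorem progeny_mono (D : OffspringData Ω) (f : ℝ → ℝ≥0∞) (s : ℝ) (ω : Ω) :
    Monotone fun n => OffspringTree.progeny f n s (D.tree ω) := by
  intro n m hnm
  simp only [progeny_eq_tsum]
  refine ENNReal.tsum_le_tsum fun w => ?_
  split_ifs with h1 h2
  · exact le_rfl
  · exact absurd ⟨h1.1.trans_le hnm, h1.2⟩ h2
  · exact zero_le
  · exact le_rfl

theorem iSup_progeny (D : OffspringData Ω) (f : ℝ → ℝ≥0∞) (s : ℝ) (ω : Ω) :
    ⨆ n, OffspringTree.progeny f n s (D.tree ω) = D.total f s ω := by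
  refine le_antisymm (iSup_le fun n => ?_) ?_
  · rw [progeny_eq_tsum]
    refine ENNReal.tsum_le_tsum fun w => ?_
    split_ifs with h1 h2
    · exact le_rfl
    · exact absurd h1.2 h2
    · exact zero_le
    · exact le_rfl
  · rw [total, ENNReal.tsum_eq_iSup_sum]
    refine iSup_le fun F => ?_
    -- A finite set of words involves only finitely many generations.
    refine le_iSup_of_le (F.sup List.length + 1) ?_
    rw [progeny_eq_tsum]
    refine le_trans (Finset.sum_le_sum fun w hw => ?_) (ENNReal.sum_le_tsum F)
    have : w.length < F.sup List.length + 1 :=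
      Nat.lt_succ_of_le (Finset.le_sup (f := List.length) hw)
    split_ifs with h1 h2
    · exact le_rfl
    · exact absurd ⟨this, h1⟩ h2
    · exact zero_le
    · exact le_rfl

variable [MeasurableSpace Ω] {D : OffspringData Ω} {a b c d : ℝ} {P : Measure Ω}
  {f : ℝ → ℝ≥0∞}

theorem measurable_total (hD : D.IsPoissonBranching a b c d P) (hf : Measurable f) (s : ℝ) :
    Measurable (D.total f s) := by
  have : D.total f s = fun ω => ⨆ n, OffspringTree.progeny f n s (D.tree ω) :=
    funext fun ω => (D.iSup_progeny f s ω).symm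
  rw [this]
  exact Measurable.iSup fun n => measurable_progeny_tree hD hf n s

variable [IsProbabilityMeasure P] [IsFiniteMeasure (offspringIntensity a b c d)]

theorem IsPoissonBranching.lintegral_total (hD : D.IsPoissonBranching a b c d P)
    (hf : Measurable f) (s : ℝ) :
    ∫⁻ ω, D.total f s ω ∂P = ⨆ n, renewalMean (displacementIntensity a b c d) f n s := by
  simp_rw [← iSup_progeny, ← hD.lintegral_progeny hf]
  exact lintegral_iSup (fun n => measurable_progeny_tree hD hf n s)
    fun n m h ω => D.progeny_mono f s ω h

theorem IsPoissonBranching.lintegral_total_sq (hD : D.IsPoissonBranching a b c d P)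
    (hf : Measurable f) {C : ℝ≥0} (hC : ∀ s, f s ≤ C) (s : ℝ) :
    ∫⁻ ω, D.total f s ω * D.total f s ω ∂P =
      ⨆ n, renewalSq (displacementIntensity a b c d) f n s := by
  have h : ∀ ω, D.total f s ω * D.total f s ω = ⨆ n, OffspringTree.progeny f n s (D.tree ω) *
      OffspringTree.progeny f n s (D.tree ω) := fun ω => by
    rw [← iSup_progeny]
    simp_rw [← sq]
    exact ENNReal.iSup_pow _ _
  simp_rw [h, ← hD.lintegral_progeny_sq hf hC]
  exact lintegral_iSup (fun n => (measurable_progeny_tree hD hf n s).mul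
    (measurable_progeny_tree hD hf n s))
    fun n m h ω => mul_le_mul' (D.progeny_mono f s ω h) (D.progeny_mono f s ω h)

end OffspringData

/-! ### Subcritical renewal recursions: uniform bounds and the integral identity. -/

theorem ENNReal.le_mul_inv_of_affine_recursion {u : ℕ → ℝ≥0∞} {K ν : ℝ≥0∞} (hν : ν < 1)
    (h0 : u 0 = 0) (h : ∀ n, u (n + 1) ≤ K + ν * u n) (n : ℕ) : u n ≤ K * (1 - ν)⁻¹ := by
  induction n with
  | zero => simp [h0]
  | succ n ih =>
    have h1 : (1 - ν) * (1 - ν)⁻¹ = 1 :=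
      ENNReal.mul_inv_cancel (tsub_pos_of_lt hν).ne' (by simp)
    calc u (n + 1) ≤ K + ν * (K * (1 - ν)⁻¹) := (h n).trans (by gcongr)
      _ = K * ((1 - ν) * (1 - ν)⁻¹) + ν * (K * (1 - ν)⁻¹) := by rw [h1, mul_one]
      _ = K * ((1 - ν + ν) * (1 - ν)⁻¹) := by ring
      _ = K * (1 - ν)⁻¹ := by rw [tsub_add_cancel_of_le hν.le, one_mul]

section Renewal

variable {ρ : Measure ℝ} {f f' : ℝ → ℝ≥0∞} {F : ℝ → ℝ≥0∞}

theorem lintegral_measure_Ioi (hρ : ∀ᵐ v ∂ρ, 0 ≤ v) :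
    ∫⁻ s in Ioi 0, ρ (Ioi s) = ∫⁻ v, ENNReal.ofReal v ∂ρ :=
  (lintegral_eq_lintegral_meas_lt ρ hρ aemeasurable_id).symm

/-- The suprema over `s` satisfy the affine recursion, since integrating against `ρ` costs at most
the factor `ρ univ`. -/
theorem le_of_renewal_recursion (hν : ρ univ < 1) {F : ℕ → ℝ → ℝ≥0∞} {g : ℝ → ℝ≥0∞}
    {K : ℝ≥0∞} (hg : ∀ s, g s ≤ K) (h0 : ∀ s, F 0 s = 0)
    (h : ∀ n s, F (n + 1) s ≤ g s + ∫⁻ v, F n (s + v) ∂ρ) (n : ℕ) (s : ℝ) :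
    F n s ≤ K * (1 - ρ univ)⁻¹ := by
  refine (le_iSup (F n) s).trans
    (ENNReal.le_mul_inv_of_affine_recursion (u := fun n => ⨆ s, F n s) hν (by simp [h0])
      (fun n => iSup_le fun s => (h n s).trans (add_le_add (hg s) ?_)) n)
  rw [mul_comm, ← lintegral_const]
  exact lintegral_mono fun v => le_iSup (F n) _

theorem renewalMean_le (hν : ρ univ < 1) (hf : ∀ s, f s ≤ 1) (n : ℕ) (s : ℝ) :
    renewalMean ρ f n s ≤ (1 - ρ univ)⁻¹ := by
  simpa using le_of_renewal_recursion hν (F := renewalMean ρ f) (g := f) hf (fun _ => rfl)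
    (fun n s => le_rfl) n s

theorem renewalSq_le (hν : ρ univ < 1) (hf : ∀ s, f s ≤ 1) (n : ℕ) (s : ℝ) :
    renewalSq ρ f n s ≤ (1 - ρ univ)⁻¹ ^ 3 := by
  refine (le_of_renewal_recursion hν (F := renewalSq ρ f)
    (g := fun _ => (1 - ρ univ)⁻¹ * (1 - ρ univ)⁻¹) (fun s => le_rfl) (fun _ => rfl)
    (fun n s => ?_) n s).trans_eq (by ring)
  exact add_le_add (mul_le_mul' (renewalMean_le hν hf _ _) (renewalMean_le hν hf _ _)) le_rfl

/-- Displacements are nonnegative, so a tree started beyond `t` never sees `f` at or below `t`. -/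
theorem renewalMean_congr (hρ : ∀ᵐ v ∂ρ, 0 ≤ v) {t : ℝ} (h : ∀ s, t < s → f s = f' s) (n : ℕ)
    {s : ℝ} (hs : t < s) : renewalMean ρ f n s = renewalMean ρ f' n s := by
  induction n generalizing s with
  | zero => rfl
  | succ n ih =>
    simp only [renewalMean]
    rw [h s hs, lintegral_congr_ae (hρ.mono fun v hv => ih (by linarith))]

theorem renewalSq_congr (hρ : ∀ᵐ v ∂ρ, 0 ≤ v) {t : ℝ} (h : ∀ s, t < s → f s = f' s) (n : ℕ)
    {s : ℝ} (hs : t < s) : renewalSq ρ f n s = renewalSq ρ f' n s := by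
  induction n generalizing s with
  | zero => rfl
  | succ n ih =>
    simp only [renewalSq]
    rw [renewalMean_congr hρ h _ hs,
      lintegral_congr_ae (hρ.mono fun v hv => ih (by linarith))]

variable [IsFiniteMeasure ρ]

theorem setLIntegral_Iio_add (F : ℝ → ℝ≥0∞) {v : ℝ} (hv : 0 ≤ v) :
    ∫⁻ s in Iio 0, F (s + v) = (∫⁻ s in Iio 0, F s) +
      ∫⁻ s in Ioi 0, F s * (Iio v).indicator 1 s := by
  have h1 : ∫⁻ s in Iio 0, F (s + v) = ∫⁻ s in Iio v, F s := by
    rw [← lintegral_indicator measurableSet_Iio, ← lintegral_indicator measurableSet_Iio]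
    refine Eq.trans (lintegral_congr fun s => ?_)
      (lintegral_add_right_eq_self ((Iio v).indicator F) v)
    simp [indicator_apply]
  have h2 : ∫⁻ s in Ioi 0, F s * (Iio v).indicator 1 s = ∫⁻ s in Ico 0 v, F s := by
    rw [setLIntegral_congr Ioi_ae_eq_Ici, ← lintegral_indicator measurableSet_Ici,
      ← lintegral_indicator measurableSet_Ico]
    refine lintegral_congr fun s => ?_
    by_cases h : 0 ≤ s <;> by_cases h' : s < v <;> simp [indicator_apply, h, h']
  rw [h1, h2, ← lintegral_union measurableSet_Ico, Iio_union_Ico_eq_Iio hv]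
  rw [Set.disjoint_left]
  intro s hs hs'
  exact absurd hs (not_lt.2 hs'.1)

/-- A shift by `v` moves `(-∞,0)` to `(-∞,v)`; the excess over `[0,v)`, integrated in `v`, weights
`F s` by `ρ (Ioi s)`. -/
theorem setLIntegral_Iio_lintegral_add (hρ : ∀ᵐ v ∂ρ, 0 ≤ v) (hF : Measurable F) :
    ∫⁻ s in Iio 0, ∫⁻ v, F (s + v) ∂ρ =
      ρ univ * (∫⁻ s in Iio 0, F s) + ∫⁻ s in Ioi 0, F s * ρ (Ioi s) := by
  have hF' : Measurable (Function.uncurry fun s v : ℝ => F (s + v)) :=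
    hF.comp (measurable_fst.add measurable_snd)
  rw [lintegral_lintegral_swap hF'.aemeasurable,
    lintegral_congr_ae (hρ.mono fun v hv => setLIntegral_Iio_add F hv)]
  have hm : Measurable (Function.uncurry fun v s : ℝ => F s * (Iio v).indicator 1 s) := by
    refine (hF.comp measurable_snd).mul ?_
    have : (fun p : ℝ × ℝ => (Iio p.1).indicator (1 : ℝ → ℝ≥0∞) p.2) =
        {p : ℝ × ℝ | p.2 < p.1}.indicator 1 := by
      ext p; simp [indicator_apply]
    rw [this]
    exact measurable_one.indicator (measurableSet_lt measurable_snd measurable_fst)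
  rw [lintegral_add_left measurable_const, lintegral_const, mul_comm,
    lintegral_lintegral_swap hm.aemeasurable]
  congr 1
  refine lintegral_congr fun s => ?_
  have : ∀ v, (Iio v).indicator (1 : ℝ → ℝ≥0∞) s = (Ioi s).indicator 1 v := fun v => by
    simp [indicator_apply]
  simp_rw [this]
  rw [lintegral_const_mul _ (measurable_one.indicator measurableSet_Ioi),
    lintegral_indicator_one measurableSet_Ioi]

/-- The integrals over `s < 0` again obey an affine recursion: the contribution of `s > 0` is at
most `K` times the integral of the tail of `ρ`, the first moment of `ρ`. Starting at `F 0 = 0` is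
what excludes the solution `∞`. -/
theorem setLIntegral_Iio_le_of_renewal_recursion (hρ : ∀ᵐ v ∂ρ, 0 ≤ v) (hν : ρ univ < 1)
    {F : ℕ → ℝ → ℝ≥0∞} {g : ℝ → ℝ≥0∞} {K : ℝ≥0∞} (hg : Measurable g)
    (hF : ∀ n, Measurable (F n)) (hK : ∀ n s, F n s ≤ K) (h0 : ∀ s, F 0 s = 0)
    (h : ∀ n s, F (n + 1) s ≤ g s + ∫⁻ v, F n (s + v) ∂ρ) (n : ℕ) :
    ∫⁻ s in Iio 0, F n s ≤
      ((∫⁻ s in Iio 0, g s) + K * ∫⁻ v, ENNReal.ofReal v ∂ρ) * (1 - ρ univ)⁻¹ := by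
  refine ENNReal.le_mul_inv_of_affine_recursion (u := fun n => ∫⁻ s in Iio 0, F n s) hν
    (by simp [h0]) (fun n => ?_) n
  calc ∫⁻ s in Iio 0, F (n + 1) s
      ≤ ∫⁻ s in Iio 0, (g s + ∫⁻ v, F n (s + v) ∂ρ) := lintegral_mono fun s => h n s
    _ = (∫⁻ s in Iio 0, g s) + (ρ univ * (∫⁻ s in Iio 0, F n s)
          + ∫⁻ s in Ioi 0, F n s * ρ (Ioi s)) := by
        rw [lintegral_add_left hg, setLIntegral_Iio_lintegral_add hρ (hF n)]
    _ ≤ (∫⁻ s in Iio 0, g s) + (ρ univ * (∫⁻ s in Iio 0, F n s)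
          + K * ∫⁻ v, ENNReal.ofReal v ∂ρ) := by
        gcongr
        rw [← lintegral_measure_Ioi hρ,
          ← lintegral_const_mul _
            (Antitone.measurable fun s t hst => measure_mono (Ioi_subset_Ioi hst))]
        exact lintegral_mono fun s => mul_le_mul' (hK n s) le_rfl
    _ = _ := by ring

theorem renewalMean_le_succ (ρ : Measure ℝ) (f : ℝ → ℝ≥0∞) (n : ℕ) (s : ℝ) :
    renewalMean ρ f n s ≤ renewalMean ρ f (n + 1) s := by
  induction n generalizing s with
  | zero => exact zero_le
  | succ n ih => exact add_le_add le_rfl (lintegral_mono fun v => ih _)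

theorem renewalSq_le_succ (ρ : Measure ℝ) (f : ℝ → ℝ≥0∞) (n : ℕ) (s : ℝ) :
    renewalSq ρ f n s ≤ renewalSq ρ f (n + 1) s := by
  induction n generalizing s with
  | zero => exact zero_le
  | succ n ih =>
    exact add_le_add (mul_le_mul' (renewalMean_le_succ ρ f _ s) (renewalMean_le_succ ρ f _ s))
      (lintegral_mono fun v => ih _)

theorem renewalMean_zero (ρ : Measure ℝ) (n : ℕ) (s : ℝ) : renewalMean ρ 0 n s = 0 := by
  induction n generalizing s with
  | zero => rfl
  | succ n ih => simp [renewalMean, ih]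

theorem renewalSq_zero (ρ : Measure ℝ) (n : ℕ) (s : ℝ) : renewalSq ρ 0 n s = 0 := by
  induction n generalizing s with
  | zero => rfl
  | succ n ih => simp [renewalSq, renewalMean_zero, ih]

theorem measurable_iSup_renewalMean (hf : Measurable f) :
    Measurable fun s => ⨆ n, renewalMean ρ f n s :=
  Measurable.iSup fun n => measurable_renewalMean hf n

theorem measurable_iSup_renewalSq (hf : Measurable f) :
    Measurable fun s => ⨆ n, renewalSq ρ f n s :=
  Measurable.iSup fun n => measurable_renewalSq hf n

theorem iSup_renewalSq_eq (hf : Measurable f) (s : ℝ) :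
    ⨆ n, renewalSq ρ f n s = (⨆ n, renewalMean ρ f n s) ^ 2 +
      ∫⁻ v, (⨆ n, renewalSq ρ f n (s + v)) ∂ρ := by
  have m1 : Monotone fun n => renewalMean ρ f n s :=
    monotone_nat_of_le_succ fun n => renewalMean_le_succ ρ f n s
  have m2 : ∀ s, Monotone fun n => renewalSq ρ f n s :=
    fun s => monotone_nat_of_le_succ fun n => renewalSq_le_succ ρ f n s
  -- Monotone convergence in the recursion. The mean and the left side enter it with index `n + 1`,
  -- hence the two shifts of index.
  rw [lintegral_iSup (f := fun n v => renewalSq ρ f n (s + v))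
    (fun n => (measurable_renewalSq hf n).comp (measurable_const_add s)) fun n m h v => m2 _ h,
    ← m1.iSup_nat_add 1, ENNReal.iSup_pow,
    ENNReal.iSup_add_iSup_of_monotone, ← (m2 s).iSup_nat_add 1]
  · simp only [renewalSq, sq]
  · intro n m h
    exact pow_le_pow_left' (m1 (by gcongr)) 2
  · intro n m h
    exact lintegral_mono fun v => m2 _ h

/-- The identity behind the final formula. The unknown integral stays on both sides because in
`ℝ≥0∞` it cannot be moved before it is known to be finite. -/
theorem setLIntegral_iSup_renewalSq_eq (hρ : ∀ᵐ v ∂ρ, 0 ≤ v) (hf : Measurable f) :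
    ∫⁻ s in Iio 0, ⨆ n, renewalSq ρ f n s =
      (∫⁻ s in Iio 0, (⨆ n, renewalMean ρ f n s) ^ 2)
        + ρ univ * (∫⁻ s in Iio 0, ⨆ n, renewalSq ρ f n s)
        + ∫⁻ s in Ioi 0, (⨆ n, renewalSq ρ f n s) * ρ (Ioi s) := by
  conv_lhs => enter [2, s]; rw [iSup_renewalSq_eq hf]
  rw [lintegral_add_left ((measurable_iSup_renewalMean hf).pow_const 2),
    setLIntegral_Iio_lintegral_add hρ (measurable_iSup_renewalSq hf), add_assoc]

theorem setLIntegral_renewalMean_le (hρ : ∀ᵐ v ∂ρ, 0 ≤ v) (hν : ρ univ < 1) (hf : Measurable f)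
    (hf1 : ∀ s, f s ≤ 1) (hf0 : ∀ s < 0, f s = 0) (n : ℕ) :
    ∫⁻ s in Iio 0, renewalMean ρ f n s ≤
      (1 - ρ univ)⁻¹ ^ 2 * ∫⁻ v, ENNReal.ofReal v ∂ρ := by
  refine (setLIntegral_Iio_le_of_renewal_recursion hρ hν hf (measurable_renewalMean hf)
    (renewalMean_le hν hf1) (fun _ => rfl) (fun n s => le_rfl) n).trans_eq ?_
  rw [setLIntegral_congr_fun measurableSet_Iio (g := 0) (fun s hs => hf0 s hs)]
  simp only [Pi.zero_apply, lintegral_zero]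
  ring

/-- One factor of the square is bounded by its supremum, the other is integrated. -/
theorem setLIntegral_renewalMean_sq_le (hρ : ∀ᵐ v ∂ρ, 0 ≤ v) (hν : ρ univ < 1)
    (hf : Measurable f) (hf1 : ∀ s, f s ≤ 1) (hf0 : ∀ s < 0, f s = 0) :
    ∫⁻ s in Iio 0, (⨆ n, renewalMean ρ f n s) ^ 2 ≤
      (1 - ρ univ)⁻¹ ^ 3 * ∫⁻ v, ENNReal.ofReal v ∂ρ := by
  simp_rw [ENNReal.iSup_pow]
  rw [lintegral_iSup (fun n => (measurable_renewalMean hf n).pow_const 2)]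
  · refine iSup_le fun n => ?_
    calc ∫⁻ s in Iio 0, renewalMean ρ f n s ^ 2
        ≤ ∫⁻ s in Iio 0, (1 - ρ univ)⁻¹ * renewalMean ρ f n s :=
          lintegral_mono fun s => by
            rw [sq]; exact mul_le_mul' (renewalMean_le hν hf1 n s) le_rfl
      _ ≤ _ := by
          rw [lintegral_const_mul _ (measurable_renewalMean hf n), pow_succ', mul_assoc]
          gcongr
          exact setLIntegral_renewalMean_le hρ hν hf hf1 hf0 n
  · intro n m h s
    exact pow_le_pow_left' (monotone_nat_of_le_succ (fun n => renewalMean_le_succ ρ f n s) h) 2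

theorem setLIntegral_iSup_renewalSq_le (hρ : ∀ᵐ v ∂ρ, 0 ≤ v) (hν : ρ univ < 1)
    (hf : Measurable f) (hf1 : ∀ s, f s ≤ 1) (hf0 : ∀ s < 0, f s = 0) :
    ∫⁻ s in Iio 0, ⨆ n, renewalSq ρ f n s ≤
      2 * (1 - ρ univ)⁻¹ ^ 4 * ∫⁻ v, ENNReal.ofReal v ∂ρ := by
  rw [lintegral_iSup (measurable_renewalSq hf)
    fun n m h s => monotone_nat_of_le_succ (fun n => renewalSq_le_succ ρ f n s) h]
  refine iSup_le fun n => ?_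
  refine (setLIntegral_Iio_le_of_renewal_recursion hρ hν
    (g := fun s => (⨆ n, renewalMean ρ f n s) ^ 2)
    ((measurable_iSup_renewalMean hf).pow_const 2) (measurable_renewalSq hf)
    (renewalSq_le hν hf1) (fun _ => rfl) (fun n s => ?_) n).trans ?_
  · rw [sq]
    exact add_le_add (mul_le_mul' (le_iSup (fun n => renewalMean ρ f n s) _)
      (le_iSup (fun n => renewalMean ρ f n s) _)) le_rfl
  -- One cube bounds the integrated source term, the other is the uniform bound on `renewalSq`;
  -- together they give the factor 2.
  · calc _ ≤ ((1 - ρ univ)⁻¹ ^ 3 * (∫⁻ v, ENNReal.ofReal v ∂ρ)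
          + (1 - ρ univ)⁻¹ ^ 3 * ∫⁻ v, ENNReal.ofReal v ∂ρ) * (1 - ρ univ)⁻¹ := by
          gcongr
          exact setLIntegral_renewalMean_sq_le hρ hν hf hf1 hf0
      _ = _ := by ring

end Renewal

/-! ### The displacement intensity: mass, tail and first moment. -/

theorem setLIntegral_Ioi_ofReal_exp {K r : ℝ} (hK : 0 ≤ K) (hr : 0 < r) (v : ℝ) :
    ∫⁻ s in Ioi v, ENNReal.ofReal (K * Real.exp (-r * s)) =
      ENNReal.ofReal (K * Real.exp (-r * v) / r) := by
  have hr' : -r < 0 := by linarith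
  rw [← ofReal_integral_eq_lintegral_ofReal ((integrableOn_exp_mul_Ioi hr' v).const_mul K)
    (Filter.Eventually.of_forall fun s => by positivity), integral_const_mul,
    integral_exp_mul_Ioi hr']
  congr 1
  field_simp

theorem lintegral_offspringIntensity (a b c d : ℝ) {g : ℝ × ℝ → ℝ≥0∞} (hg : Measurable g) :
    ∫⁻ p, g p ∂(offspringIntensity a b c d) = ∫⁻ s in Ioi 0, ∫⁻ u in Ioi 0,
      ENNReal.ofReal (a * Real.exp (-b * s) * (c * Real.exp (-(c + d) * u))) * g (s, u) := by
  have hm : Measurable fun p : ℝ × ℝ =>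
    ENNReal.ofReal (a * Real.exp (-b * p.1) * (c * Real.exp (-(c + d) * p.2))) := by fun_prop
  rw [offspringIntensity, lintegral_withDensity_eq_lintegral_mul _ hm hg, Measure.volume_eq_prod,
    ← Measure.prod_restrict, lintegral_prod _ (hm.mul hg).aemeasurable,
    setLIntegral_congr Ioi_ae_eq_Ici.symm]
  simp_rw [setLIntegral_congr (μ := volume) (Ioi_ae_eq_Ici (a := (0 : ℝ))).symm]
  rfl

theorem displacementIntensity_nonneg (a b c d : ℝ) :
    ∀ᵐ v ∂(displacementIntensity a b c d), 0 ≤ v := by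
  rw [displacementIntensity, ae_map_iff (by fun_prop) measurableSet_Ici]
  refine (withDensity_absolutelyContinuous _ _).ae_le ?_
  filter_upwards [ae_restrict_mem (measurableSet_Ici.prod measurableSet_Ici)] with p hp
  exact add_nonneg hp.1 hp.2

section DisplacementIntensity

variable {a b c d : ℝ}

theorem displacementIntensity_Ioi (ha : 0 ≤ a) (hc : 0 ≤ c) (hq : 0 < c + d) (v : ℝ) :
    displacementIntensity a b c d (Ioi v) = ∫⁻ s in Ioi 0,
      ENNReal.ofReal (a * c / (c + d) *
        Real.exp (-b * s + -(c + d) * max (v - s) 0)) := by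
  have hm : Measurable fun p : ℝ × ℝ => p.1 + p.2 := by fun_prop
  rw [displacementIntensity, Measure.map_apply hm measurableSet_Ioi,
    ← lintegral_indicator_one (hm measurableSet_Ioi),
    lintegral_offspringIntensity a b c d (measurable_one.indicator (hm measurableSet_Ioi))]
  refine lintegral_congr fun s => ?_
  have h1 : ∀ u : ℝ, ENNReal.ofReal (a * Real.exp (-b * s) * (c * Real.exp (-(c + d) * u))) *
      ((fun p : ℝ × ℝ => p.1 + p.2) ⁻¹' Ioi v).indicator 1 (s, u) =
      (Ioi (v - s)).indicator
        (fun u => ENNReal.ofReal (a * Real.exp (-b * s) * c * Real.exp (-(c + d) * u))) u := by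
    intro u
    by_cases h : v < s + u
    · have h' : v - s < u := by linarith
      simp [h, h', mul_assoc]
    · have h' : ¬ v - s < u := by linarith
      simp [h, h']
  simp_rw [h1]
  rw [setLIntegral_indicator measurableSet_Ioi, Ioi_inter_Ioi,
    setLIntegral_Ioi_ofReal_exp (by positivity) hq, Real.exp_add]
  congr 1
  field_simp

theorem displacementIntensity_univ (ha : 0 ≤ a) (hb : 0 < b) (hc : 0 ≤ c) (hq : 0 < c + d) :
    displacementIntensity a b c d univ = ENNReal.ofReal (meanOffspring a b c d) := by
  -- Any negative threshold carries the full mass, and there the maximum in the tail formula is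
  -- zero.
  have h1 : displacementIntensity a b c d univ = displacementIntensity a b c d (Ioi (-1)) := by
    refine (measure_congr ?_).symm
    filter_upwards [displacementIntensity_nonneg a b c d] with v hv
    have : v ∈ Ioi (-1 : ℝ) := by simp only [mem_Ioi]; linarith
    exact eq_true this
  have h2 : ∀ s ∈ Ioi (0 : ℝ), ENNReal.ofReal (a * c / (c + d) *
        Real.exp (-b * s + -(c + d) * max (-1 - s) 0)) =
      ENNReal.ofReal (a * c / (c + d) * Real.exp (-b * s)) := fun s hs => by
    have hs' : (0 : ℝ) < s := hs
    rw [max_eq_right (by linarith), mul_zero, add_zero]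
  rw [h1, displacementIntensity_Ioi ha hc hq, setLIntegral_congr_fun measurableSet_Ioi h2,
    setLIntegral_Ioi_ofReal_exp (by positivity) hb, meanOffspring]
  congr 1
  simp
  field_simp

/-- The two terms are the contributions of `s ≤ v` and `s > v` to the tail beyond `v`. This form
also makes the sign of `tailKernel` visible. -/
theorem intervalIntegral_exp_mul_exp {b q v : ℝ} (hb : b ≠ 0) :
    ((∫ s in (0 : ℝ)..v, Real.exp (-b * s + -q * (v - s))) + Real.exp (-b * v) / b) =
      tailKernel b q v / b := by
  unfold tailKernel
  split_ifs with h
  · subst h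
    have : ∀ s, Real.exp (-q * s + -q * (v - s)) = Real.exp (-q * v) := fun s => by
      congr 1; ring
    simp_rw [this]
    rw [intervalIntegral.integral_const, smul_eq_mul]
    field_simp
    ring
  · have hqb : q - b ≠ 0 := sub_ne_zero.2 h
    have hd : ∀ s ∈ uIcc 0 v, HasDerivAt (fun s => Real.exp (-b * s + -q * (v - s)) / (q - b))
        (Real.exp (-b * s + -q * (v - s))) s := by
      intro s _
      have h1 : HasDerivAt (fun s : ℝ => -b * s + -q * (v - s)) (-b * 1 + -q * (0 - 1)) s :=
        ((hasDerivAt_id s).const_mul (-b)).add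
          (((hasDerivAt_const s v).sub (hasDerivAt_id s)).const_mul (-q))
      convert! (h1.exp).div_const (q - b) using 1
      field_simp
      ring
    rw [intervalIntegral.integral_eq_sub_of_hasDerivAt hd
      ((by fun_prop : Continuous _).intervalIntegrable _ _)]
    simp only [sub_self, mul_zero, add_zero, zero_add, sub_zero]
    field_simp
    ring

theorem displacementIntensity_Ioi_eq_tailKernel (ha : 0 ≤ a) (hb : 0 < b) (hc : 0 ≤ c)
    (hq : 0 < c + d) {v : ℝ} (hv : 0 ≤ v) :
    displacementIntensity a b c d (Ioi v) =
      ENNReal.ofReal (meanOffspring a b c d * tailKernel b (c + d) v) := by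
  set q := c + d
  have hK : 0 ≤ a * c / q := by positivity
  have h2 : ∀ s ∈ Ioi v, ENNReal.ofReal (a * c / q * Real.exp (-b * s + -q * max (v - s) 0)) =
      ENNReal.ofReal (a * c / q * Real.exp (-b * s)) := fun s hs => by
    have hs' : v < s := hs
    rw [max_eq_right (by linarith), mul_zero, add_zero]
  have h3 : ∀ s ∈ Ioc 0 v,
      ENNReal.ofReal (a * c / q * Real.exp (-b * s + -q * max (v - s) 0)) =
      ENNReal.ofReal (a * c / q * Real.exp (-b * s + -q * (v - s))) := fun s hs => by
    rw [max_eq_left (by linarith [hs.2])]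
  have hint : IntegrableOn (fun s => a * c / q * Real.exp (-b * s + -q * (v - s))) (Ioc 0 v) :=
    (Continuous.integrableOn_Icc (by fun_prop)).mono_set Ioc_subset_Icc_self
  rw [displacementIntensity_Ioi ha hc hq, ← Ioc_union_Ioi_eq_Ioi hv,
    lintegral_union measurableSet_Ioi (Ioc_disjoint_Ioi le_rfl),
    setLIntegral_congr_fun measurableSet_Ioi h2, setLIntegral_congr_fun measurableSet_Ioc h3,
    setLIntegral_Ioi_ofReal_exp hK hb, ← ofReal_integral_eq_lintegral_ofReal hint
      (Filter.Eventually.of_forall fun s => by positivity), ← ENNReal.ofReal_add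
      (integral_nonneg fun s => by positivity) (by positivity), integral_const_mul,
    ← intervalIntegral.integral_of_le hv, mul_div_assoc (a * c / q), ← mul_add,
    intervalIntegral_exp_mul_exp hb.ne', meanOffspring]
  congr 1
  change a * c / q * (tailKernel b q v / b) = a * c / (b * q) * tailKernel b q v
  field_simp

theorem tailKernel_nonneg {q v : ℝ} (hb : 0 < b) (hv : 0 ≤ v) : 0 ≤ tailKernel b q v := by
  have h : 0 ≤ tailKernel b q v / b := by
    rw [← intervalIntegral_exp_mul_exp hb.ne']
    exact add_nonneg (intervalIntegral.integral_nonneg hv fun s _ => by positivity)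
      (by positivity)
  simpa [div_mul_cancel₀ _ hb.ne'] using mul_nonneg h hb.le

theorem continuous_tailKernel (b q : ℝ) : Continuous (tailKernel b q) := by
  unfold tailKernel
  split_ifs <;> fun_prop

theorem lintegral_ofReal_displacementIntensity_lt_top (ha : 0 ≤ a) (hb : 0 < b) (hc : 0 ≤ c)
    (hq : 0 < c + d) : ∫⁻ v, ENNReal.ofReal v ∂(displacementIntensity a b c d) < ∞ := by
  have hm : Measurable fun p : ℝ × ℝ => p.1 + p.2 := by fun_prop
  rw [displacementIntensity, lintegral_map (by fun_prop) hm,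
    lintegral_offspringIntensity a b c d (by fun_prop)]
  set q := c + d
  -- Chosen so that `s + u ≤ K (b s / 2 + q u / 2)`; the linear factor then costs only half of the
  -- exponential decay.
  set K := 2 / b + 2 / q
  have hK : 0 ≤ K := by positivity
  have h : ∀ s ∈ Ioi (0 : ℝ), ∀ u ∈ Ioi (0 : ℝ),
      ENNReal.ofReal (a * Real.exp (-b * s) * (c * Real.exp (-q * u))) *
        ENNReal.ofReal (s + u) ≤
      ENNReal.ofReal (a * c * K * Real.exp (-(b / 2) * s) * Real.exp (-(q / 2) * u)) := by
    intro s hs u hu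
    have hs' : (0 : ℝ) < s := hs
    have hu' : (0 : ℝ) < u := hu
    rw [← ENNReal.ofReal_mul (by positivity)]
    refine ENNReal.ofReal_le_ofReal ?_
    have h1 : s + u ≤ K * Real.exp (b / 2 * s + q / 2 * u) := by
      have e1 : b / 2 * s + q / 2 * u ≤ Real.exp (b / 2 * s + q / 2 * u) := by
        linarith [Real.add_one_le_exp (b / 2 * s + q / 2 * u)]
      have e2 : K * (b / 2 * s + q / 2 * u) = s + u + (q / b * u + b / q * s) := by
        simp only [K]; field_simp; ring
      have e3 : 0 ≤ q / b * u + b / q * s := by positivity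
      nlinarith [mul_le_mul_of_nonneg_left e1 hK]
    calc a * Real.exp (-b * s) * (c * Real.exp (-q * u)) * (s + u)
        ≤ a * Real.exp (-b * s) * (c * Real.exp (-q * u)) *
          (K * Real.exp (b / 2 * s + q / 2 * u)) := by gcongr
      _ = a * c * K * (Real.exp (-b * s) * Real.exp (-q * u) *
          Real.exp (b / 2 * s + q / 2 * u)) := by ring
      _ = _ := by
        rw [mul_assoc (a * c * K), ← Real.exp_add, ← Real.exp_add, ← Real.exp_add]
        congr 2
        ring
  calc _ ≤ ∫⁻ s in Ioi 0, ∫⁻ u in Ioi 0, ENNReal.ofReal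
          (a * c * K * Real.exp (-(b / 2) * s) * Real.exp (-(q / 2) * u)) :=
        setLIntegral_mono' measurableSet_Ioi fun s hs =>
          setLIntegral_mono' measurableSet_Ioi fun u hu => h s hs u hu
    _ = ∫⁻ s in Ioi 0, ENNReal.ofReal (a * c * K / (q / 2) * Real.exp (-(b / 2) * s)) := by
        refine lintegral_congr fun s => ?_
        rw [setLIntegral_Ioi_ofReal_exp (by positivity) (by positivity)]
        congr 1
        simp
        field_simp
    _ < ∞ := by
        rw [setLIntegral_Ioi_ofReal_exp (by positivity) (by positivity)]
        exact ENNReal.ofReal_lt_top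

end DisplacementIntensity

/-! ### The process as a functional `total` of the tree. -/

namespace OffspringData

section Deterministic

variable {Ω : Type*} (D : OffspringData Ω) {f f₁ f₂ : ℝ → ℝ≥0∞} {s s₁ s₂ : ℝ}

theorem total_congr (h : ∀ v, f (s + v) = f₁ (s₁ + v)) (ω : Ω) :
    D.total f s ω = D.total f₁ s₁ ω := by
  simp only [total, h]

theorem total_add (h : ∀ v, f (s + v) = f₁ (s₁ + v) + f₂ (s₂ + v)) (ω : Ω) :
    D.total f s ω = D.total f₁ s₁ ω + D.total f₂ s₂ ω := by
  simp only [total, h]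
  rw [← ENNReal.tsum_add]
  refine tsum_congr fun w => ?_
  split_ifs <;> simp

theorem total_mono (h : ∀ v, f (s + v) ≤ f₁ (s₁ + v)) (ω : Ω) :
    D.total f s ω ≤ D.total f₁ s₁ ω := by
  refine ENNReal.tsum_le_tsum fun w => ?_
  split_ifs
  · exact h _
  · exact le_rfl

theorem total_Iic (t : ℝ) (ω : Ω) :
    D.total ((Iic t).indicator 1) 0 ω = ((D.bornBy t ω).encard : ℝ≥0∞) := by
  rw [← ENNReal.tsum_set_one, tsum_subtype (D.bornBy t ω) (fun _ => (1 : ℝ≥0∞)), total]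
  refine tsum_congr fun w => ?_
  by_cases h1 : D.IsBorn ω w <;> by_cases h2 : D.birthTime ω w ≤ t <;>
    simp [bornBy, h1, h2]

/-- No exceptional set is needed: for an infinite population `ncard` and `toReal` both take the
value 0. -/
theorem Z_eq_toReal (t : ℝ) (ω : Ω) :
    D.Z t ω = (D.total ((Iic t).indicator 1) 0 ω).toReal := by
  rw [total_Iic, Z, ncard_def]
  rcases (D.bornBy t ω).finite_or_infinite with h | h
  · obtain ⟨n, hn⟩ := ENat.ne_top_iff_exists.1 h.encard_lt_top.ne
    simp [← hn]
  · simp [h.encard_eq]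

theorem bornBy_finite {t : ℝ} {ω : Ω} (h : D.total 1 0 ω < ∞) : (D.bornBy t ω).Finite := by
  have h1 : D.total ((Iic t).indicator 1) 0 ω < ∞ :=
    (D.total_mono (fun v => indicator_le_self' (by simp) _) ω).trans_lt h
  rw [total_Iic] at h1
  rw [← encard_lt_top_iff]
  simpa using h1

theorem total_lt_top {ω : Ω} (h : D.total 1 0 ω < ∞) (hf : ∀ v, f v ≤ 1) :
    D.total f s ω < ∞ :=
  (D.total_mono (fun _ => hf _) ω).trans_lt h

/-- Births in `(r, r + t]` are births in `(0, t]` once the ancestor is moved to time `-r`.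
Finiteness is needed here, to subtract. -/
theorem Z_sub {ω : Ω} (h : D.total 1 0 ω < ∞) (r : ℝ) {t : ℝ} (ht : 0 ≤ t) :
    D.Z (r + t) ω - D.Z r ω = (D.total ((Ioc 0 t).indicator 1) (-r) ω).toReal := by
  have hle : ∀ (S : Set ℝ) (v : ℝ), S.indicator (1 : ℝ → ℝ≥0∞) v ≤ 1 :=
    fun S v => indicator_le_self' (by simp) _
  have := D.total_add (f := (Iic (r + t)).indicator 1) (f₁ := (Iic r).indicator 1)
    (f₂ := (Ioc 0 t).indicator 1) (s := 0) (s₁ := 0) (s₂ := -r) (fun v => by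
      by_cases h1 : v ≤ r
      · have h2 : v ≤ r + t := by linarith
        have h3 : ¬ r < v := not_lt.2 h1
        simp [h1, h2, h3]
      · by_cases h2 : v ≤ r + t
        · have h3 : r < v := not_le.1 h1
          have h4 : -r + v ≤ t := by linarith
          simp [h1, h2, h3, h4]
        · have h4 : ¬ -r + v ≤ t := fun h => h2 (by linarith)
          simp [h1, h2, h4]) ω
  rw [Z_eq_toReal, Z_eq_toReal, this, ENNReal.toReal_add (D.total_lt_top h (hle _)).ne
    (D.total_lt_top h (hle _)).ne, add_sub_cancel_left]

end Deterministic

end OffspringData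

/-! ### Moments of the process as renewal functions. -/

theorem setLIntegral_Ioi_neg (F : ℝ → ℝ≥0∞) :
    ∫⁻ r in Ioi 0, F (-r) = ∫⁻ s in Iio 0, F s := by
  rw [← lintegral_indicator measurableSet_Ioi, ← lintegral_indicator measurableSet_Iio]
  refine Eq.trans (lintegral_congr fun s => ?_)
    ((Measure.measurePreserving_neg volume).lintegral_comp_emb
      (Homeomorph.neg ℝ).measurableEmbedding ((Iio 0).indicator F))
  simp [indicator_apply]

section SecondMoment

variable {Ω : Type*} [MeasurableSpace Ω] {P : Measure Ω} {T : Ω → ℝ≥0∞}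

theorem memLp_two_toReal (hT : Measurable T) (h2 : ∫⁻ ω, T ω * T ω ∂P ≠ ∞) :
    MemLp (fun ω => (T ω).toReal) 2 P := by
  rw [memLp_two_iff_integrable_sq hT.ennreal_toReal.aestronglyMeasurable]
  simp_rw [sq, ← ENNReal.toReal_mul]
  exact integrable_toReal_of_lintegral_ne_top (hT.mul hT).aemeasurable h2

theorem integral_toReal_sq (hT : Measurable T) (h2 : ∫⁻ ω, T ω * T ω ∂P ≠ ∞) :
    ∫ ω, (T ω).toReal ^ 2 ∂P = (∫⁻ ω, T ω * T ω ∂P).toReal := by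
  simp_rw [sq, ← ENNReal.toReal_mul]
  exact integral_toReal (hT.mul hT).aemeasurable (ae_lt_top (hT.mul hT) h2)

end SecondMoment

namespace OffspringData

variable {Ω : Type*} [MeasurableSpace Ω] {D : OffspringData Ω} {a b c d : ℝ} {P : Measure Ω}
  [IsProbabilityMeasure P] [IsFiniteMeasure (offspringIntensity a b c d)]
  {f : ℝ → ℝ≥0∞}

theorem lintegral_total_sq_lt_top (hD : D.IsPoissonBranching a b c d P)
    (hν : displacementIntensity a b c d univ < 1) (hf : Measurable f) (hf1 : ∀ v, f v ≤ 1)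
    (s : ℝ) : ∫⁻ ω, D.total f s ω * D.total f s ω ∂P < ∞ := by
  rw [hD.lintegral_total_sq hf (C := 1) (by simpa using hf1)]
  refine (iSup_le fun n => renewalSq_le hν hf1 n s).trans_lt (ENNReal.pow_lt_top ?_)
  exact ENNReal.inv_lt_top.2 (tsub_pos_of_lt hν)

/-- `total 1 0` counts everyone ever born, so a single null set serves all times. -/
theorem ae_total_lt_top (hD : D.IsPoissonBranching a b c d P)
    (hν : displacementIntensity a b c d univ < 1) : ∀ᵐ ω ∂P, D.total 1 0 ω < ∞ := by
  have hm := measurable_total (f := 1) hD measurable_one 0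
  filter_upwards [ae_lt_top (hm.mul hm)
    (lintegral_total_sq_lt_top (f := 1) hD hν measurable_one (fun v => le_rfl) 0).ne] with ω h
  by_contra h'
  rw [not_lt_top_iff] at h'
  simp [h'] at h

theorem memLp_Z (hD : D.IsPoissonBranching a b c d P)
    (hν : displacementIntensity a b c d univ < 1) (t : ℝ) : MemLp (D.Z t) 2 P := by
  have hf : Measurable ((Iic t).indicator (1 : ℝ → ℝ≥0∞)) :=
    measurable_one.indicator measurableSet_Iic
  have : D.Z t = fun ω => (D.total ((Iic t).indicator 1) 0 ω).toReal :=
    funext fun ω => D.Z_eq_toReal t ω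
  rw [this]
  exact memLp_two_toReal (measurable_total hD hf 0) (lintegral_total_sq_lt_top hD hν hf
    (fun v => indicator_le_self' (by simp) _) 0).ne

theorem w_eq (hD : D.IsPoissonBranching a b c d P)
    (hν : displacementIntensity a b c d univ < 1) (r : ℝ) {t : ℝ} (ht : 0 ≤ t) :
    D.w P r t = (⨆ n, renewalSq (displacementIntensity a b c d)
      ((Ioc 0 t).indicator 1) n (-r)).toReal := by
  have hf : Measurable ((Ioc 0 t).indicator (1 : ℝ → ℝ≥0∞)) :=
    measurable_one.indicator measurableSet_Ioc
  have hf1 : ∀ v, (Ioc 0 t).indicator (1 : ℝ → ℝ≥0∞) v ≤ 1 :=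
    fun v => indicator_le_self' (by simp) _
  rw [← hD.lintegral_total_sq hf (C := 1) (by simpa using hf1),
    ← integral_toReal_sq (measurable_total hD hf _)
      (lintegral_total_sq_lt_top hD hν hf hf1 _).ne, w]
  refine integral_congr_ae ?_
  filter_upwards [ae_total_lt_top hD hν] with ω h
  rw [D.Z_sub h r ht]

theorem x_sub (hD : D.IsPoissonBranching a b c d P)
    (hν : displacementIntensity a b c d univ < 1) (r : ℝ) {t : ℝ} (ht : 0 ≤ t) :
    D.x P (r + t) - D.x P r = (⨆ n, renewalMean (displacementIntensity a b c d)
      ((Ioc 0 t).indicator 1) n (-r)).toReal := by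
  have hf : Measurable ((Ioc 0 t).indicator (1 : ℝ → ℝ≥0∞)) :=
    measurable_one.indicator measurableSet_Ioc
  have hf1 : ∀ v, (Ioc 0 t).indicator (1 : ℝ → ℝ≥0∞) v ≤ 1 :=
    fun v => indicator_le_self' (by simp) _
  rw [← hD.lintegral_total hf, x, x, ← integral_sub
    ((memLp_Z hD hν _).integrable one_le_two) ((memLp_Z hD hν _).integrable one_le_two),
    ← integral_toReal (measurable_total hD hf _).aemeasurable
      ((ae_total_lt_top hD hν).mono fun ω h => D.total_lt_top h hf1)]
  refine integral_congr_ae ?_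
  filter_upwards [ae_total_lt_top hD hν] with ω h
  rw [D.Z_sub h r ht]

/-- The left side is the second moment of `Z_u`. Starting the ancestor at `t - u` turns births by
`u` into births by `t`, so one function `f` serves all `u`. -/
theorem x_sq_add_y (hD : D.IsPoissonBranching a b c d P)
    (hν : displacementIntensity a b c d univ < 1) (t u : ℝ) :
    D.x P u ^ 2 + D.y P u = (⨆ n, renewalSq (displacementIntensity a b c d)
      ((Iic t).indicator 1) n (t - u)).toReal := by
  have hf : Measurable ((Iic t).indicator (1 : ℝ → ℝ≥0∞)) :=
    measurable_one.indicator measurableSet_Iic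
  have hf1 : ∀ v, (Iic t).indicator (1 : ℝ → ℝ≥0∞) v ≤ 1 :=
    fun v => indicator_le_self' (by simp) _
  rw [y, variance_eq_sub (memLp_Z hD hν u), x, add_sub_cancel,
    ← hD.lintegral_total_sq hf (C := 1) (by simpa using hf1),
    ← integral_toReal_sq (measurable_total hD hf _)
      (lintegral_total_sq_lt_top hD hν hf hf1 _).ne]
  refine integral_congr_ae (Filter.Eventually.of_forall fun ω => ?_)
  simp only [Pi.pow_apply]
  rw [D.Z_eq_toReal, D.total_congr (f₁ := (Iic t).indicator 1) (s₁ := t - u)]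
  intro v
  by_cases h : v ≤ u
  · have h' : t - u + v ≤ t := by linarith
    simp [h, h']
  · have h' : ¬ t - u + v ≤ t := fun h' => h (by linarith)
    simp [h, h']

end OffspringData

theorem isFiniteMeasure_offspringIntensity {a b c d : ℝ} (ha : 0 ≤ a) (hb : 0 < b) (hc : 0 ≤ c)
    (hq : 0 < c + d) : IsFiniteMeasure (offspringIntensity a b c d) where
  measure_univ_lt_top := by
    have h := displacementIntensity_univ ha hb hc hq
    rw [displacementIntensity, Measure.map_apply (by fun_prop) MeasurableSet.univ,
      preimage_univ] at h
    rw [h]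
    exact ENNReal.ofReal_lt_top

namespace OffspringData

variable {Ω : Type*} [MeasurableSpace Ω] {D : OffspringData Ω} {a b c d : ℝ} {P : Measure Ω}
  [IsProbabilityMeasure P] [IsFiniteMeasure (offspringIntensity a b c d)]

theorem intervalIntegrable_tailKernel_mul (hD : D.IsPoissonBranching a b c d P)
    (hν : displacementIntensity a b c d univ < 1) {t : ℝ} (ht : 0 ≤ t) :
    IntervalIntegrable (fun u => tailKernel b (c + d) (t - u) * (D.x P u ^ 2 + D.y P u))
      volume 0 t := by
  have hf1 : ∀ v, (Iic t).indicator (1 : ℝ → ℝ≥0∞) v ≤ 1 :=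
    fun v => indicator_le_self' (by simp) _
  rw [intervalIntegrable_iff_integrableOn_Ioc_of_le ht]
  have hk : IntegrableOn (fun u => tailKernel b (c + d) (t - u)) (Ioc 0 t) :=
    (((continuous_tailKernel b (c + d)).comp (continuous_const.sub continuous_id)
      ).integrableOn_Icc).mono_set Ioc_subset_Icc_self
  simp_rw [x_sq_add_y hD hν t]
  refine hk.mul_bdd (c := ((1 - displacementIntensity a b c d univ)⁻¹ ^ 3).toReal) ?_ ?_
  · exact (((measurable_iSup_renewalSq (measurable_one.indicator measurableSet_Iic)).comp
      (measurable_const.sub measurable_id)).ennreal_toReal).aestronglyMeasurable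
  · refine Filter.Eventually.of_forall fun u => ?_
    rw [Real.norm_of_nonneg ENNReal.toReal_nonneg]
    exact ENNReal.toReal_mono (ENNReal.pow_lt_top (ENNReal.inv_lt_top.2 (tsub_pos_of_lt hν))).ne
      (iSup_le fun n => renewalSq_le hν hf1 n _)

/-- For `s > t` nothing is counted. For `0 < s ≤ t` the lower end of `(0,t]` is invisible, so the
window may be replaced by `Iic t` and `x_sq_add_y` applies with `u = t - s`. -/
theorem setLIntegral_renewalSq_mul_tail (hD : D.IsPoissonBranching a b c d P)
    (ha : 0 ≤ a) (hb : 0 < b) (hc : 0 ≤ c) (hq : 0 < c + d)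
    (hν : displacementIntensity a b c d univ < 1) {t : ℝ} (ht : 0 ≤ t) :
    ∫⁻ s in Ioi 0, (⨆ n, renewalSq (displacementIntensity a b c d) ((Ioc 0 t).indicator 1) n s) *
        displacementIntensity a b c d (Ioi s) =
      ENNReal.ofReal (meanOffspring a b c d *
        ∫ u in (0 : ℝ)..t, tailKernel b (c + d) (t - u) * (D.x P u ^ 2 + D.y P u)) := by
  set ρ := displacementIntensity a b c d with hρdef
  have hρ := displacementIntensity_nonneg a b c d
  have hm : 0 ≤ meanOffspring a b c d := by unfold meanOffspring; positivity
  set h : ℝ → ℝ := fun u => tailKernel b (c + d) (t - u) * (D.x P u ^ 2 + D.y P u) with hh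
  have hnn : ∀ s ∈ Ioc 0 t, 0 ≤ meanOffspring a b c d * h (t - s) := by
    intro s hs
    refine mul_nonneg hm (mul_nonneg (tailKernel_nonneg hb ?_) ?_)
    · linarith [hs.1]
    · rw [x_sq_add_y hD hν t]
      exact ENNReal.toReal_nonneg
  have hint : IntegrableOn (fun s => meanOffspring a b c d * h (t - s)) (Ioc 0 t) := by
    have h1 := (intervalIntegrable_tailKernel_mul hD hν ht).comp_sub_left t
    rw [sub_zero, sub_self] at h1
    rw [← intervalIntegrable_iff_integrableOn_Ioc_of_le ht]
    exact h1.symm.const_mul _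
  have hlarge : ∀ s ∈ Ioi t, (⨆ n, renewalSq ρ ((Ioc 0 t).indicator 1) n s) * ρ (Ioi s) = 0 := by
    intro s hs
    have : ∀ n, renewalSq ρ ((Ioc 0 t).indicator 1) n s = 0 := fun n => by
      rw [renewalSq_congr hρ (f' := 0) (t := t) (fun v hv => ?_) n hs, renewalSq_zero]
      have : v ∉ Ioc 0 t := fun hv' => absurd hv'.2 (not_le.2 hv)
      simp [indicator_of_notMem this]
    simp [this]
  have hsmall : ∀ s ∈ Ioc 0 t, (⨆ n, renewalSq ρ ((Ioc 0 t).indicator 1) n s) * ρ (Ioi s) =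
      ENNReal.ofReal (meanOffspring a b c d * h (t - s)) := by
    intro s hs
    have h1 : ∀ n, renewalSq ρ ((Ioc 0 t).indicator 1) n s =
        renewalSq ρ ((Iic t).indicator 1) n s := fun n =>
      renewalSq_congr hρ (t := 0) (fun v hv => by simp [indicator_apply, hv]) n hs.1
    have hf1 : ∀ v, (Iic t).indicator (1 : ℝ → ℝ≥0∞) v ≤ 1 :=
      fun v => indicator_le_self' (by simp) _
    have hfin : ⨆ n, renewalSq ρ ((Iic t).indicator 1) n s ≠ ∞ :=
      ((iSup_le fun n => renewalSq_le hν hf1 n s).trans_lt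
        (ENNReal.pow_lt_top (ENNReal.inv_lt_top.2 (tsub_pos_of_lt hν)))).ne
    simp only [hh, sub_sub_cancel]
    rw [x_sq_add_y hD hν t, sub_sub_cancel, ← mul_assoc, ENNReal.ofReal_mul
      (mul_nonneg hm (tailKernel_nonneg hb hs.1.le)), ENNReal.ofReal_toReal hfin,
      displacementIntensity_Ioi_eq_tailKernel ha hb hc hq hs.1.le, mul_comm]
    simp_rw [h1]
  rw [← Ioc_union_Ioi_eq_Ioi ht, lintegral_union measurableSet_Ioi (Ioc_disjoint_Ioi le_rfl),
    setLIntegral_congr_fun measurableSet_Ioi hlarge,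
    setLIntegral_congr_fun measurableSet_Ioc hsmall, lintegral_zero, add_zero,
    ← ofReal_integral_eq_lintegral_ofReal hint
      ((ae_restrict_iff' measurableSet_Ioc).2 (Filter.Eventually.of_forall hnn)),
    integral_const_mul, ← intervalIntegral.integral_of_le ht,
    intervalIntegral.integral_comp_sub_left h t, sub_self, sub_zero]

end OffspringData

/-! ### The main theorem. -/

theorem proposition3p1 {Ω : Type*} [MeasurableSpace Ω] (P : Measure Ω) [IsProbabilityMeasure P]
    (a b c d : ℝ) (ha : 0 ≤ a) (hb : 0 < b) (hc : 0 < c) (hd : 0 ≤ d)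
    (hstab : a * c < b * (c + d))
    (D : OffspringData Ω) (hD : D.IsPoissonBranching a b c d P) :
    -- the process is a.s. finite and has finite second moments, so that `x`, `y`, `w` make sense
    (∀ᵐ ω ∂P, ∀ t : ℝ, (D.bornBy t ω).Finite) ∧
    (∀ t : ℝ, 0 ≤ t → MemLp (D.Z t) 2 P) ∧
    -- integrability in `r` and the formula for the integral, all integrals being convergent
    (∀ t : ℝ, 0 ≤ t →
      IntegrableOn (fun r => D.w P r t) (Ioi 0) ∧
      IntegrableOn (fun r => (D.x P (r + t) - D.x P r) ^ 2) (Ioi 0) ∧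
      IntervalIntegrable
        (fun u => tailKernel b (c + d) (t - u) * (D.x P u ^ 2 + D.y P u)) volume 0 t ∧
      (∫ r in Ioi 0, D.w P r t) =
        1 / (1 - meanOffspring a b c d) * (∫ r in Ioi 0, (D.x P (r + t) - D.x P r) ^ 2)
        + meanOffspring a b c d / (1 - meanOffspring a b c d) *
          (∫ u in (0 : ℝ)..t, tailKernel b (c + d) (t - u) * (D.x P u ^ 2 + D.y P u))) ∧
    -- uniform boundedness in `t`
    (∃ C : ℝ, ∀ t : ℝ, 0 ≤ t → (∫ r in Ioi 0, D.w P r t) ≤ C) := by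
  have hq : 0 < c + d := by linarith
  have := isFiniteMeasure_offspringIntensity ha hb hc.le hq
  have hm0 : 0 ≤ meanOffspring a b c d := by unfold meanOffspring; positivity
  have hm1 : meanOffspring a b c d < 1 := by
    unfold meanOffspring
    rwa [div_lt_one (by positivity)]
  set ρ := displacementIntensity a b c d with hρdef
  have hρ := displacementIntensity_nonneg a b c d
  have hρu : ρ univ = ENNReal.ofReal (meanOffspring a b c d) :=
    displacementIntensity_univ ha hb hc.le hq
  have hν : ρ univ < 1 := by
    rw [hρu, ← ENNReal.ofReal_one]
    exact (ENNReal.ofReal_lt_ofReal_iff one_pos).2 hm1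
  have hmean := lintegral_ofReal_displacementIntensity_lt_top ha hb hc.le hq
  have hinv : (1 - ρ univ)⁻¹ < ∞ := ENNReal.inv_lt_top.2 (tsub_pos_of_lt hν)
  have hf : ∀ t : ℝ, Measurable ((Ioc 0 t).indicator (1 : ℝ → ℝ≥0∞)) :=
    fun t => measurable_one.indicator measurableSet_Ioc
  have hf1 : ∀ t v : ℝ, (Ioc 0 t).indicator (1 : ℝ → ℝ≥0∞) v ≤ 1 :=
    fun t v => indicator_le_self' (by simp) _
  have hf0 : ∀ t, ∀ v < 0, (Ioc 0 t).indicator (1 : ℝ → ℝ≥0∞) v = 0 := fun t v hv =>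
    indicator_of_notMem (fun h => absurd h.1 (not_lt.2 hv.le)) _
  set W : ℝ → ℝ → ℝ≥0∞ := fun t s => ⨆ n, renewalSq ρ ((Ioc 0 t).indicator 1) n s with hW
  set U : ℝ → ℝ → ℝ≥0∞ := fun t s => (⨆ n, renewalMean ρ ((Ioc 0 t).indicator 1) n s) ^ 2 with hU
  have mW : ∀ t, Measurable fun r => W t (-r) := fun t =>
    (measurable_iSup_renewalSq (hf t)).comp measurable_neg
  have mU : ∀ t, Measurable fun r => U t (-r) := fun t =>
    ((measurable_iSup_renewalMean (hf t)).pow_const 2).comp measurable_neg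
  have hWle : ∀ t, ∫⁻ s in Iio 0, W t s ≤ _ := fun t =>
    setLIntegral_iSup_renewalSq_le hρ hν (hf t) (hf1 t) (hf0 t)
  -- This bound does not involve `t`; it gives both integrability and the uniform constant.
  have hCfin : 2 * (1 - ρ univ)⁻¹ ^ 4 * ∫⁻ v, ENNReal.ofReal v ∂ρ ≠ ∞ :=
    (ENNReal.mul_lt_top (ENNReal.mul_lt_top (by simp) (ENNReal.pow_lt_top hinv)) hmean).ne
  have hWfin : ∀ t, ∫⁻ s in Iio 0, W t s ≠ ∞ := fun t => ne_top_of_le_ne_top hCfin (hWle t)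
  have hUfin : ∀ t, ∫⁻ s in Iio 0, U t s ≠ ∞ := fun t =>
    ((setLIntegral_renewalMean_sq_le hρ hν (hf t) (hf1 t) (hf0 t)).trans_lt
      (ENNReal.mul_lt_top (ENNReal.pow_lt_top hinv) hmean)).ne
  have hWfin' : ∀ t, ∫⁻ r in Ioi 0, W t (-r) ≠ ∞ := fun t => by
    rw [setLIntegral_Ioi_neg]; exact hWfin t
  have hUfin' : ∀ t, ∫⁻ r in Ioi 0, U t (-r) ≠ ∞ := fun t => by
    rw [setLIntegral_Ioi_neg]; exact hUfin t
  have hw : ∀ t, 0 ≤ t → (fun r => D.w P r t) = fun r => (W t (-r)).toReal :=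
    fun t ht => funext fun r => OffspringData.w_eq hD hν r ht
  have hx : ∀ t, 0 ≤ t →
      (fun r => (D.x P (r + t) - D.x P r) ^ 2) = fun r => (U t (-r)).toReal :=
    fun t ht => funext fun r => by
      rw [OffspringData.x_sub hD hν r ht, ← ENNReal.toReal_pow]
  have hwint : ∀ t, 0 ≤ t → ∫ r in Ioi 0, D.w P r t = (∫⁻ s in Iio 0, W t s).toReal := by
    intro t ht
    rw [hw t ht, integral_toReal (mW t).aemeasurable (ae_lt_top (mW t) (hWfin' t)),
      setLIntegral_Ioi_neg]
  have hxint : ∀ t, 0 ≤ t →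
      ∫ r in Ioi 0, (D.x P (r + t) - D.x P r) ^ 2 = (∫⁻ s in Iio 0, U t s).toReal := by
    intro t ht
    rw [hx t ht, integral_toReal (mU t).aemeasurable (ae_lt_top (mU t) (hUfin' t)),
      setLIntegral_Ioi_neg]
  refine ⟨?_, fun t _ => OffspringData.memLp_Z hD hν t, fun t ht => ⟨?_, ?_,
    OffspringData.intervalIntegrable_tailKernel_mul hD hν ht, ?_⟩,
    ⟨(2 * (1 - ρ univ)⁻¹ ^ 4 * ∫⁻ v, ENNReal.ofReal v ∂ρ).toReal, fun t ht => ?_⟩⟩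
  · filter_upwards [OffspringData.ae_total_lt_top hD hν] with ω h t
    exact D.bornBy_finite h
  · rw [hw t ht]
    exact integrable_toReal_of_lintegral_ne_top (mW t).aemeasurable (hWfin' t)
  · rw [hx t ht]
    exact integrable_toReal_of_lintegral_ne_top (mU t).aemeasurable (hUfin' t)
  · rw [hwint t ht, hxint t ht]
    -- All terms being finite, the identity passes to `ℝ`, where it is linear in the unknown
    -- integral with coefficient `1 - ν ≠ 0`.
    have key := congrArg ENNReal.toReal (setLIntegral_iSup_renewalSq_eq hρ (hf t))
    rw [OffspringData.setLIntegral_renewalSq_mul_tail hD ha hb hc.le hq hν ht] at key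
    have hI : 0 ≤ ∫ u in (0 : ℝ)..t,
        tailKernel b (c + d) (t - u) * (D.x P u ^ 2 + D.y P u) := by
      refine intervalIntegral.integral_nonneg ht fun u hu => mul_nonneg
        (tailKernel_nonneg hb (by linarith [hu.2])) ?_
      rw [OffspringData.x_sq_add_y hD hν t]
      exact ENNReal.toReal_nonneg
    rw [ENNReal.toReal_add (ENNReal.add_ne_top.2
        ⟨hUfin t, ENNReal.mul_ne_top (measure_ne_top _ _) (hWfin t)⟩) ENNReal.ofReal_ne_top,
      ENNReal.toReal_add (hUfin t) (ENNReal.mul_ne_top (measure_ne_top _ _) (hWfin t)),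
      ENNReal.toReal_mul, ENNReal.toReal_ofReal (mul_nonneg hm0 hI), hρu,
      ENNReal.toReal_ofReal hm0] at key
    have h1 : 1 - meanOffspring a b c d ≠ 0 := by linarith
    field_simp
    simp only [hW, hU]
    linarith
  · rw [hwint t ht]
    exact ENNReal.toReal_mono hCfin (hWle t)
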